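/- **Setting.** Let $G$ be a countable discrete group and $\mu$ an admissible probability measure on $G$ (its support generates $G$ as a semigroup) with finite Shannon entropy $-\sum_g \mu(g)\log\mu(g)<\infty$. Let $\mathrm{Sub}_G$ be the space of subgroups of $G$, with the Borel $\sigma$-algebra generated by the sets $\{K : g\in K\}$; $G$ acts on it by conjugation. For a conjugation-invariant Borel probability measure $\lambda$ on $\mathrm{Sub}_G$ let $\mathbb P_\lambda$ be the law of $(K;KZ_0,KZ_1,\dots)$, where $K$ has law $\lambda$ and $Z_n=X_1\cdots X_n$, $Z_0=e$, with $X_i$ i.i.d. of law $\mu$, independent of $K$. On the space of all sequences $(K;Kg_0,Kg_1,\dots)$ the shift $(K;Kg_0,Kg_1,\dots)\mapsto(K;Kg_1,Kg_2,\dots)$ commutes with the $G$-action $\gamma(K;Kg_0,\dots)=(\gamma K\gamma^{-1};\gamma Kg_0,\dots)$. The Poisson boundary $(B(\mathrm{Sub}_G),\nu_\lambda)$ is the space of ergodic components of this shift: a standard Borel $G$-space with a map $\mathbf{bnd}$ from the sequence space that is measurable with respect to the $\sigma$-algebra of shift-invariant Borel sets, generates it modulo $\mathbb P_\lambda$-null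 sets and is $G$-equivariant $\mathbb P_\lambda$-almost everywhere, and $\nu_\lambda=\mathbf{bnd}_*\mathbb P_\lambda$. Put $$h_\mu(\lambda):=h_\mu(B(\mathrm{Sub}_G),\nu_\lambda)=\iint-\log\frac{d(\nu_\lambda\circ g)}{d\nu_\lambda}(x)\,d\nu_\lambda(x)\,d\mu(g),\qquad (\nu_\lambda\circ g)(E)=\nu_\lambda(gE).$$ **Lemma 4.8.** Let $\rho$ be a Borel probability measure on $\mathrm{Sub}_G\times\mathrm{Sub}_G$ with $K_1\le K_2$ for $\rho$-almost every $(K_1,K_2)$, invariant under the diagonal conjugation action of $G$, and let $\rho_1,\rho_2$ be its two marginals. Then $h_\mu(\rho_1)\ge h_\mu(\rho_2)$. **Percolation paths.** Now let $G=\langle a,b\rangle$ be the free group of rank $2$ and $\mu$ the uniform probability measure on $\{a,b,a^{-1},b^{-1}\}$. For $n\ge1$ let $K_n\le G$ be the subgroup generated by all $ghg^{-1}$ with $g\in\langle a^n,b^n\rangle$ and $h=a^kb^ra^{-k}$ or $h=b^ka^rb^{-k}$, where $1\le|k|\le n-1$ and $r\in\mathbb Z$; it has finitely many conjugates. For $K\le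 G$ let $X_K$ be the 2-complex obtained from the Schreier coset graph of $K\backslash G$ (edges $(Kg,Kga)$ labelled $a$ and $(Kg,Kgb)$ labelled $b$) by attaching a 2-cell along every loop and along every pair of distinct edges with the same endpoints. For a set $\omega$ of 2-cells of $X_K$ let $\Psi(K,\omega)=S_{K,\omega}$ be the subgroup of $K$ generated by all $gsg^{-1}$ such that a 2-cell not in $\omega$ is bounded by a loop at $Kg$ labelled $s\in\{a^{\pm1},b^{\pm1}\}$, and all $gs_1s_2^{-1}g^{-1}$ such that a 2-cell not in $\omega$ is bounded by two distinct edges labelled $s_1,s_2\in\{a^{\pm1},b^{\pm1}\}$ from $Kg$ to $Kgs_1=Kgs_2$. For $p\in[0,1]$ let $\eta_{n,p}$ be the law of $(K',\omega)$, where $K'$ is a uniformly random conjugate of $K_n$ and, given $K'$, each 2-cell of $X_{K'}$ belongs to $\omega$ independently with probability $p$. **Corollary 4.9.** For every $n\ge1$ the function $p\mapsto h_\mu(\Psi_*\eta_{n,p})$ is monotone increasing on $[0,1]$: if $0\le p\le q\le1$, then $h_\mu(\Psi_*\eta_{n,p})\le h_\mu(\Psi_*\eta_{n,q})$. -/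

import Mathlib

open MeasureTheory ProbabilityTheory Filter
open scoped ENNReal symmDiff unitInterval

noncomputable section

namespace IRSWalk

universe u

/-! ### Furstenberg entropy -/

/-- The `μ`-entropy of a measurable action of `G` on the measure space `(X, η)`,
`∬ -log (d(η ∘ g)/dη)(x) dη(x) dμ(g)`, where `(η ∘ g)(E) = η (g E)`; thus `η ∘ g` is the image
of `η` under the action of `g⁻¹`. It is the integral of the positive part minus the integral of the
negative part, as an extended real number. (For a probability measure `η` the second integral is
at most `1`, because `log⁺ t ≤ t`, so the difference is never `∞ - ∞`.) -/
def furstenbergEntropy {G X : Type*} [Group G] [MeasurableSpace G] [MeasurableSpace X]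
    [MulAction G X] (μ : Measure G) (η : Measure X) : EReal :=
  ((∫⁻ g, ∫⁻ x, (-ENNReal.log ((η.map (fun y => g⁻¹ • y)).rnDeriv η x)).toENNReal ∂η ∂μ :
      ℝ≥0∞) : EReal)
    - ((∫⁻ g, ∫⁻ x, (ENNReal.log ((η.map (fun y => g⁻¹ • y)).rnDeriv η x)).toENNReal ∂η ∂μ :
      ℝ≥0∞) : EReal)

/-- A probability measure on a countable discrete group is admissible if its support generates the
group as a semigroup (absolute continuity is automatic for a discrete group). -/
def IsAdmissible {G : Type*} [Group G] [MeasurableSpace G] (μ : Measure G) : Prop :=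
  Subsemigroup.closure {g : G | μ {g} ≠ 0} = ⊤

/-- The Shannon entropy `-∑ μ(g) log μ(g)` is finite. -/
def HasFiniteEntropy {G : Type*} [MeasurableSpace G] (μ : Measure G) : Prop :=
  Summable fun g : G => Real.negMulLog (μ.real {g})

/-! ### The space of subgroups and the space of paths in coset spaces -/

section General

variable {G : Type u} [Group G]

/-- The Borel σ-algebra of the space of subgroups of a countable discrete group: it is generated by
the sets `{K | g ∈ K}`. -/
instance : MeasurableSpace (Subgroup G) :=
  MeasurableSpace.comap (fun K : Subgroup G => (K : Set G)) inferInstance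

/-- The conjugate `γ K γ⁻¹`. -/
def conjSubgroup (γ : G) (K : Subgroup G) : Subgroup G := K.map (MulAut.conj γ).toMonoidHom

/-- The coset `K g`, as a subset of `G`. -/
def rightCoset (K : Subgroup G) (g : G) : Set G := {x | ∃ k ∈ K, x = k * g}

variable (G) in
/-- The space of all `(K; K g₀, K g₁, …)`, a subspace of `Sub_G × (2^G)^ℕ` (with the subspace
σ-algebra). -/
abbrev CosetPath : Type u :=
  {c : Subgroup G × (ℕ → Set G) // ∀ n, ∃ g, c.2 n = rightCoset c.1 g}

/-- The time shift `(K; K g₀, K g₁, …) ↦ (K; K g₁, K g₂, …)`. -/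
def shift (c : CosetPath G) : CosetPath G := ⟨(c.1.1, fun n => c.1.2 (n + 1)), fun n => c.2 (n + 1)⟩

theorem image_rightCoset (γ : G) (K : Subgroup G) (g : G) :
    (fun x => γ * x) '' rightCoset K g = rightCoset (conjSubgroup γ K) (γ * g) := by
  ext x
  constructor
  · rintro ⟨_, ⟨k, hk, rfl⟩, rfl⟩
    exact ⟨γ * k * γ⁻¹, ⟨k, hk, rfl⟩, by simp [mul_assoc]⟩
  · rintro ⟨_, ⟨k, hk, rfl⟩, rfl⟩
    exact ⟨k * g, ⟨k, hk, rfl⟩, by simp [mul_assoc]⟩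

/-- The action `γ (K; K g₀, K g₁, …) = (γ K γ⁻¹; γ K g₀, γ K g₁, …)`. -/
def translate (γ : G) (c : CosetPath G) : CosetPath G :=
  ⟨(conjSubgroup γ c.1.1, fun n => (fun x => γ * x) '' c.1.2 n), fun n => by
    obtain ⟨g, hg⟩ := c.2 n
    exact ⟨γ * g, by simp only [hg, image_rightCoset]⟩⟩

/-- The positions `1, x₀, x₀ x₁, x₀ x₁ x₂, …` of the walk with increments `x₀, x₁, …`. -/
def walk (x : ℕ → G) : ℕ → G
  | 0 => 1
  | n + 1 => walk x n * x n

/-- The path `(K; K Z₀, K Z₁, …)` for the walk `Z` with given increments. -/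
def cosetWalk (q : Subgroup G × (ℕ → G)) : CosetPath G :=
  ⟨(q.1, fun n => rightCoset q.1 (walk q.2 n)), fun n => ⟨walk q.2 n, rfl⟩⟩

variable [MeasurableSpace G]

/-- The law of `(K; K Z₀, K Z₁, …)`, where `K` has law `lam` and `Z` is an independent random walk
with `Z₀ = 1` and independent increments of law `μ`. -/
def cosetWalkLaw (μ : Measure G) (lam : Measure (Subgroup G)) : Measure (CosetPath G) :=
  (lam.prod (Measure.infinitePi fun _ : ℕ => μ)).map cosetWalk

/-- A realization of the Poisson boundary of the random walk on the random coset space `K \ G`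
with `K` of law `lam`, that is, of the space of ergodic components of the time shift on
the space of coset paths: a standard Borel `G`-space together with a map `bnd` that is measurable
with respect to the σ-algebra of shift-invariant Borel sets, generates this σ-algebra up to null
sets, and is `G`-equivariant almost everywhere. -/
structure PoissonBoundary (μ : Measure G) (lam : Measure (Subgroup G)) where
  space : Type u
  [measurableSpace : MeasurableSpace space]
  [standardBorelSpace : StandardBorelSpace space]
  [action : MulAction G space]
  measurable_action : ∀ g : G, Measurable fun b : space => g • b
  bnd : CosetPath G → space
  measurable_bnd : Measurable[MeasurableSpace.invariants (shift (G := G))] bnd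
  generates : ∀ A : Set (CosetPath G), MeasurableSet[MeasurableSpace.invariants shift] A →
    ∃ E : Set space, MeasurableSet E ∧ bnd ⁻¹' E =ᵐ[cosetWalkLaw μ lam] A
  equivariant : ∀ g : G, ∀ᵐ c ∂(cosetWalkLaw μ lam), bnd (translate g c) = g • bnd c

attribute [instance] PoissonBoundary.measurableSpace PoissonBoundary.standardBorelSpace
  PoissonBoundary.action

/-- The harmonic measure `ν_lam` on the Poisson boundary. -/
def PoissonBoundary.harmonicMeasure {μ : Measure G} {lam : Measure (Subgroup G)}
    (B : PoissonBoundary μ lam) : Measure B.space := (cosetWalkLaw μ lam).map B.bnd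

/-- The `μ`-entropy `h_μ(B(Sub_G), ν_lam)` of the Poisson boundary. -/
def PoissonBoundary.entropy {μ : Measure G} {lam : Measure (Subgroup G)}
    (B : PoissonBoundary μ lam) : EReal := furstenbergEntropy μ B.harmonicMeasure

end General

/-! ### Existence of the Poisson boundary -/

section Existence

variable {G : Type u} [Group G]

theorem mem_conjSubgroup {γ : G} {K : Subgroup G} {x : G} :
    x ∈ conjSubgroup γ K ↔ γ⁻¹ * x * γ ∈ K := by
  constructor
  · rintro ⟨k, hk, rfl⟩
    simpa [mul_assoc] using hk
  · intro h
    exact ⟨_, h, by simp [mul_assoc]⟩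

theorem translate_mul (γ δ : G) (c : CosetPath G) :
    translate (γ * δ) c = translate γ (translate δ c) := by
  apply Subtype.ext
  refine Prod.ext ?_ ?_
  · apply Subgroup.ext
    intro x
    simp only [translate, mem_conjSubgroup, mul_inv_rev, mul_assoc]
  · funext n
    simp only [translate, Set.image_image, mul_assoc]

theorem translate_shift (γ : G) (c : CosetPath G) :
    translate γ (shift c) = shift (translate γ c) := rfl

theorem measurable_translate (γ : G) : Measurable (translate (G := G) γ) := by
  refine Measurable.subtype_mk (Measurable.prodMk ?_ ?_)
  · refine Measurable.comp (g := conjSubgroup γ) ?_ (measurable_fst.comp measurable_subtype_coe)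
    refine measurable_comap_iff.2 (measurable_set_iff.2 fun x => ?_)
    have h := (measurable_set_iff.1 (comap_measurable (fun K : Subgroup G => (K : Set G))))
      (γ⁻¹ * x * γ)
    simpa [mem_conjSubgroup] using h
  · refine measurable_pi_iff.2 fun n => measurable_set_iff.2 fun x => ?_
    have h : Measurable fun c : CosetPath G => c.1.2 n :=
      (measurable_pi_apply n).comp (measurable_snd.comp measurable_subtype_coe)
    have h' := measurable_set_iff.1 h (γ⁻¹ * x)
    have he : (fun c : CosetPath G => x ∈ (translate γ c).1.2 n)
        = fun c : CosetPath G => γ⁻¹ * x ∈ c.1.2 n := by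
      funext c
      refine propext ⟨?_, fun hx => ⟨_, hx, by simp⟩⟩
      rintro ⟨y, hy, rfl⟩
      simpa using hy
    exact he ▸ h'

/-- Up to null sets, a sub-σ-algebra is generated by a sequence of its members. -/
theorem exists_seq_approx {X : Type*} (m : MeasurableSpace X) {m₀ : MeasurableSpace X}
    [MeasurableSpace.CountablyGenerated X] (P : Measure X) [IsFiniteMeasure P] (hm : m ≤ m₀) :
    ∃ D : ℕ → Set X, (∀ n, MeasurableSet[m] (D n)) ∧
      ∀ A, MeasurableSet[m] A → ∀ ε : ℝ≥0∞, 0 < ε → ∃ n, P (A ∆ D n) < ε := by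
  classical
  obtain ⟨𝒜, hc, hd⟩ := exists_countable_measureDense (μ := P)
  obtain ⟨f, hf⟩ := hc.exists_eq_range hd.nonempty
  let Q : ℕ × ℕ → Set X → Prop := fun k S =>
    MeasurableSet[m] S ∧ P (f k.1 ∆ S) < ((k.2 : ℝ≥0∞) + 1)⁻¹
  let D : ℕ × ℕ → Set X := fun k => if h : ∃ S, Q k S then h.choose else ∅
  have hD : ∀ k S, Q k S → Q k (D k) := fun k S hS => by
    have h : ∃ S, Q k S := ⟨S, hS⟩
    simp only [D, dif_pos h]
    exact h.choose_spec
  refine ⟨fun n => D n.unpair, fun n => ?_, fun A hA ε hε => ?_⟩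
  · by_cases h : ∃ S, Q n.unpair S
    · exact (hD _ _ h.choose_spec).1
    · simp only [D, dif_neg h]
      exact @MeasurableSet.empty X m
  · obtain ⟨k, hk⟩ := ENNReal.exists_inv_nat_lt (ENNReal.half_pos hε.ne').ne'
    have hk1 : ((k : ℝ≥0∞) + 1)⁻¹ < ε / 2 :=
      lt_of_le_of_lt (ENNReal.inv_le_inv.2 le_self_add) hk
    have hpos : 0 < ((k : ℝ≥0∞) + 1)⁻¹ := by simp
    obtain ⟨T, hT, hTA⟩ := hd.approx A (hm _ hA) (measure_ne_top P A)
      (((k : ℝ≥0∞) + 1)⁻¹).toReal (ENNReal.toReal_pos hpos.ne' (by simp))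
    rw [ENNReal.ofReal_toReal (by simp)] at hTA
    rw [hf] at hT
    obtain ⟨j, rfl⟩ := hT
    have hQ := hD (j, k) A ⟨hA, by rwa [symmDiff_comm]⟩
    refine ⟨Nat.pair j k, ?_⟩
    simp only [Nat.unpair_pair]
    calc P (A ∆ D (j, k)) ≤ P (A ∆ f j) + P (f j ∆ D (j, k)) := measure_symmDiff_le _ _ _
      _ < ε / 2 + ε / 2 := ENNReal.add_lt_add (hTA.trans hk1) (hQ.2.trans hk1)
      _ = ε := ENNReal.add_halves ε

variable [Countable G] [MeasurableSpace G]

/-- The Poisson boundary exists. -/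
theorem nonempty_poissonBoundary (μ : Measure G) [IsProbabilityMeasure μ]
    (lam : Measure (Subgroup G)) [IsFiniteMeasure lam] : Nonempty (PoissonBoundary μ lam) := by
  classical
  have : IsFiniteMeasure (cosetWalkLaw μ lam) := by unfold cosetWalkLaw; infer_instance
  have : MeasurableSpace.CountablyGenerated (Set G) :=
    inferInstanceAs (MeasurableSpace.CountablyGenerated (G → Prop))
  have : MeasurableSpace.CountablyGenerated (Subgroup G) :=
    MeasurableSpace.CountablyGenerated.comap _
  have : MeasurableSpace.CountablyGenerated (ℕ → Set G) :=
    inferInstanceAs (MeasurableSpace.CountablyGenerated (ℕ → G → Prop))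
  have : MeasurableSpace.CountablyGenerated (CosetPath G) :=
    MeasurableSpace.CountablyGenerated.comap _
  obtain ⟨D, hDm, hD⟩ := exists_seq_approx (MeasurableSpace.invariants (shift (G := G)))
    (cosetWalkLaw μ lam) (MeasurableSpace.invariants_le _)
  let act : MulAction G (ℕ → G → Bool) :=
    { smul := fun γ b n g => b n (γ⁻¹ * g)
      one_smul := fun b => by
        funext n g
        change b n (1⁻¹ * g) = b n g
        simp
      mul_smul := fun γ δ b => by
        funext n g
        change b n ((γ * δ)⁻¹ * g) = b n (δ⁻¹ * (γ⁻¹ * g))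
        simp [mul_assoc] }
  let bnd : CosetPath G → ℕ → G → Bool := fun c n g => decide (translate g⁻¹ c ∈ D n)
  refine ⟨{
    space := ℕ → G → Bool
    action := act
    bnd := bnd
    measurable_action := ?_
    measurable_bnd := ?_
    generates := ?_
    equivariant := ?_ }⟩
  · intro γ
    exact measurable_pi_iff.2 fun n => measurable_pi_iff.2 fun g =>
      (measurable_pi_apply (γ⁻¹ * g)).comp (measurable_pi_apply n)
  · refine @measurable_pi_iff _ _ _ (MeasurableSpace.invariants shift) _ _ |>.2 fun n =>
      @measurable_pi_iff _ _ _ (MeasurableSpace.invariants shift) _ _ |>.2 fun g => ?_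
    refine @measurable_to_bool _ (MeasurableSpace.invariants shift) _ ?_
    have he : (fun c => bnd c n g) ⁻¹' {true} = translate g⁻¹ ⁻¹' (D n) := by
      ext c
      simp [bnd]
    rw [he]
    refine ⟨measurable_translate _ (hDm n).1, ?_⟩
    ext c
    have := Set.ext_iff.1 (hDm n).2 (translate g⁻¹ c)
    simpa [translate_shift] using this
  · intro A hA
    have hpow : ∀ k : ℕ, 0 < ((2 : ℝ≥0∞)⁻¹) ^ k := fun k => by
      exact ENNReal.pow_pos (by simp) k
    choose n hn using fun k : ℕ => hD A hA _ (hpow k)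
    refine ⟨{b | ∃ᶠ k in atTop, b (n k) 1 = true}, ?_, ?_⟩
    · have : {b : ℕ → G → Bool | ∃ᶠ k in atTop, b (n k) 1 = true}
          = limsup (fun k => {b : ℕ → G → Bool | b (n k) 1 = true}) atTop := by
        ext b
        simp [mem_limsup_iff_frequently_mem]
      rw [this]
      refine MeasurableSet.measurableSet_limsup fun k => ?_
      have hm : Measurable fun b : ℕ → G → Bool => b (n k) 1 :=
        (measurable_pi_apply 1).comp (measurable_pi_apply (n k))
      exact hm (measurableSet_singleton true)
    · have hsum : ∑' k, cosetWalkLaw μ lam (A ∆ D (n k)) ≠ ∞ := by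
        refine ne_top_of_le_ne_top ?_ (ENNReal.tsum_le_tsum fun k => (hn k).le)
        rw [ENNReal.tsum_geometric]
        simp
      have hone : ∀ c : CosetPath G, translate 1 c = c := fun c => by
        apply Subtype.ext
        refine Prod.ext (Subgroup.ext fun x => ?_) (funext fun k => ?_)
        · simp [translate, mem_conjSubgroup]
        · simp [translate]
      filter_upwards [ae_eventually_notMem hsum] with c hc
      refine propext ?_
      change (∃ᶠ k in atTop, decide (translate 1⁻¹ c ∈ D (n k)) = true) ↔ c ∈ A
      simp only [inv_one, hone, decide_eq_true_eq]
      constructor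
      · intro h
        obtain ⟨k, hk, hk'⟩ := (h.and_eventually hc).exists
        by_contra hcA
        exact hk' (Or.inr ⟨hk, hcA⟩)
      · intro h
        refine Eventually.frequently (hc.mono fun k hk => ?_)
        by_contra hcD
        exact hk (Or.inl ⟨h, hcD⟩)
  · intro γ
    refine Eventually.of_forall fun c => ?_
    funext n g
    change decide (translate g⁻¹ (translate γ c) ∈ D n) = decide (translate (γ⁻¹ * g)⁻¹ c ∈ D n)
    rw [← translate_mul]
    simp

end Existence

/-! ### The free group of rank two and the percolation paths -/

/-- The free group `⟨a, b⟩` of rank two. -/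
abbrev F₂ : Type := FreeGroup (Fin 2)

instance : MeasurableSpace F₂ := ⊤

instance : DiscreteMeasurableSpace F₂ := ⟨fun _ => trivial⟩

/-- The letters `a, b` (`true`) and `a⁻¹, b⁻¹` (`false`). -/
abbrev Letter : Type := Fin 2 × Bool

/-- The group element of a letter. -/
def Letter.elt (s : Letter) : F₂ := FreeGroup.mk [s]

/-- The uniform probability measure on `{a, b, a⁻¹, b⁻¹}`. -/
def uniformStep : Measure F₂ := (4 : ℝ≥0∞)⁻¹ • ∑ s : Letter, Measure.dirac s.elt

instance : IsProbabilityMeasure uniformStep := ⟨by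
  simp only [uniformStep, Measure.smul_apply, Measure.finsetSum_apply, measure_univ, smul_eq_mul]
  simp only [Finset.sum_const, Finset.card_univ, Fintype.card_prod, Fintype.card_fin,
    Fintype.card_bool, nsmul_eq_mul, mul_one]
  norm_num
  exact ENNReal.inv_mul_cancel (by norm_num) (by norm_num)⟩

/-- The subgroup `K_n`, generated by all `g h g⁻¹` with `g ∈ ⟨aⁿ, bⁿ⟩` and `h = aᵏ bʳ a⁻ᵏ` or
`h = bᵏ aʳ b⁻ᵏ`, where `1 ≤ |k| ≤ n - 1` and `r ∈ ℤ`. -/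
def baseSubgroup (n : ℕ) : Subgroup F₂ :=
  Subgroup.closure {x | ∃ g ∈ Subgroup.closure
      {FreeGroup.of (0 : Fin 2) ^ n, FreeGroup.of (1 : Fin 2) ^ n},
    ∃ k r : ℤ, 1 ≤ |k| ∧ |k| ≤ (n : ℤ) - 1 ∧
      (x = g * (FreeGroup.of 0 ^ k * FreeGroup.of 1 ^ r * (FreeGroup.of 0 ^ k)⁻¹) * g⁻¹ ∨
        x = g * (FreeGroup.of 1 ^ k * FreeGroup.of 0 ^ r * (FreeGroup.of 1 ^ k)⁻¹) * g⁻¹)}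

/-- The set of conjugates of a subgroup. -/
def conjugates (K : Subgroup F₂) : Set (Subgroup F₂) := Set.range fun g => conjSubgroup g K

/-- The directed labelled edges of the Schreier coset graph: `(v, i)` is the edge with
label `i` (`0` for `a`, `1` for `b`) that leaves the vertex `v`. -/
abbrev SchreierEdge : Type := Set F₂ × Fin 2

/-- The edge of the Schreier coset graph of `K \ F₂` that is traversed, forwards for `a, b` and
backwards for `a⁻¹, b⁻¹`, when going from the vertex `K g` to the vertex `K g s`. -/
def edgeAt (K : Subgroup F₂) (g : F₂) (s : Letter) : SchreierEdge :=
  if s.2 then (rightCoset K g, s.1) else (rightCoset K (g * s.elt), s.1)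

/-- `c` is the set of boundary edges of a 2-cell of `X_K`: either a single loop, or
two distinct edges with the same endpoints `K g` and `K g s = K g t`. -/
inductive IsTwoCell (K : Subgroup F₂) : Set SchreierEdge → Prop
  | loop (g : F₂) (s : Letter) : rightCoset K (g * s.elt) = rightCoset K g →
      IsTwoCell K {edgeAt K g s}
  | bigon (g : F₂) (s t : Letter) : rightCoset K (g * s.elt) = rightCoset K (g * t.elt) →
      edgeAt K g s ≠ edgeAt K g t → IsTwoCell K {edgeAt K g s, edgeAt K g t}

/-- The 2-cells of the complex `X_K`. -/
abbrev TwoCell (K : Subgroup F₂) : Type := {c : Set SchreierEdge // IsTwoCell K c}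

/-- The pairs `(K, ω)` of a subgroup and a set of 2-cells of `X_K`. -/
structure Marked where
  K : Subgroup F₂
  ω : Set (TwoCell K)

/-- The cell with the given boundary edges belongs to `ω`. -/
def Marked.IsMarked (x : Marked) (c : Set SchreierEdge) : Prop := ∃ d ∈ x.ω, d.1 = c

/-- The Borel σ-algebra of the space of pairs `(K, ω)`, in which two pairs are close if the labelled
complexes and the sets of cells agree on large balls around the root: it is generated by the
events `g ∈ K` and by the events that the cell with the boundary traversed by the letters `s, t` from
`K g` belongs to `ω` (a loop if the two edges coincide). -/
instance : MeasurableSpace Marked :=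
  MeasurableSpace.comap (fun x : Marked =>
    (x.K, {q : F₂ × Letter × Letter | x.IsMarked {edgeAt x.K q.1 q.2.1, edgeAt x.K q.1 q.2.2}}))
    inferInstance

/-- The subgroup `S_{K, ω} = Ψ(K, ω)` of `K`, which belongs to the universal cover of the
complex `X_K ∖ ω`: it is generated by the `g s g⁻¹` for the loops labelled `s` at `K g` that bound a
2-cell not in `ω`, and by the `g s t⁻¹ g⁻¹` for the pairs of edges labelled `s, t` from `K g`
to `K g s = K g t` that bound a 2-cell not in `ω`. -/
def coverSubgroup (x : Marked) : Subgroup F₂ :=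
  Subgroup.closure
    ({y | ∃ (g : F₂) (s : Letter), rightCoset x.K (g * s.elt) = rightCoset x.K g ∧
        ¬ x.IsMarked {edgeAt x.K g s} ∧ y = g * s.elt * g⁻¹} ∪
      {y | ∃ (g : F₂) (s t : Letter),
        rightCoset x.K (g * s.elt) = rightCoset x.K (g * t.elt) ∧
        edgeAt x.K g s ≠ edgeAt x.K g t ∧
        ¬ x.IsMarked {edgeAt x.K g s, edgeAt x.K g t} ∧ y = g * s.elt * t.elt⁻¹ * g⁻¹})

/-- The measure `η_{n,p}`: the law of `(K', ω)`, where `K'` is a uniformly random conjugate of `K_n`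
and, given `K'`, each 2-cell of `X_{K'}` belongs to `ω` independently with probability `p`. -/
def percolation (n : ℕ) (p : I) : Measure Marked :=
  ((conjugates (baseSubgroup n)).ncard : ℝ≥0∞)⁻¹ •
    Measure.sum fun K : conjugates (baseSubgroup n) =>
      (setBernoulli (Set.univ : Set (TwoCell K.1)) p).map fun ω => Marked.mk K.1 ω

/-- The law `Ψ_* η_{n,p}` of the random subgroup `S_{K', ω}`. -/
def percolationIRS (n : ℕ) (p : I) : Measure (Subgroup F₂) :=
  (percolation n p).map coverSubgroup

end IRSWalk

end

open MeasureTheory ProbabilityTheory Filter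
open scoped ENNReal symmDiff unitInterval

/-! ### Divergences and densities -/

section Divergence

open InformationTheory

/-! Write `P_γ` for the law of the coset path started at `K γ` instead of `K`. Conjugation
invariance of the law of `K` makes the translate of the harmonic measure by `γ` equal to the image
of `P_γ` under the boundary map, and admissibility makes all these images equivalent. The entropy is
then the average over `g` of the Kullback–Leibler divergence of the harmonic measure from its
translate by `g⁻¹`, so it suffices to compare divergences for each fixed `γ`.

Given a coupling `K₁ ≤ K₂`, run both coset walks with the same increments on one space with law `θ`.
Let `f` be the density of the `γ`-translate of the first harmonic measure, and let `β₁`, `β₂` be the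
boundary points of the two walks. The claim is that `β₂` carries `(f ∘ β₁) θ` to the `γ`-translate
of the second harmonic measure. Data processing then bounds the second divergence by that of `θ`
from `(f ∘ β₁) θ`, which equals the first divergence because the density factors through `β₁`
(`klDiv_harmonicMeasure_le`).

For the claim, take a shift-invariant event for the `K₂`-path and integrate out `K₂` given `K₁`.
Paths of `K₁`-cosets project to paths of `K₂`-cosets compatibly with the shift, so the result is a
shift-invariant function of the `K₁`-path, the same for every starting point
(`exists_invariant_lintegral_eq`). On invariant functions, `f ∘ bnd` is the density of `P_γ` with
respect to `P_1` (`PoissonBoundary.lintegral_cosetWalkLawFrom`). No map between the two boundaries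
is needed.

For percolation, couple the markings for `p ≤ q` so that the smaller set is contained in the larger.
More marked cells leave fewer generators, so the subgroup for `q` lies in the one for `p`. The
coupling is invariant since conjugation permutes the finitely many conjugates of `K_n` and carries
cells to cells. -/

/-- Splits `log` into its positive and negative parts and moves every term to the side where it is
nonnegative, so that the identity can be integrated in `ℝ≥0∞` without subtraction. -/
theorem ENNReal.toENNReal_neg_log_add {t : ℝ≥0∞} (h0 : t ≠ 0) (h1 : t ≠ ∞) :
    (-ENNReal.log t).toENNReal + t
      = ENNReal.ofReal (t.toReal - 1 - Real.log t.toReal) + ((ENNReal.log t).toENNReal + 1) := by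
  have hp : 0 < t.toReal := ENNReal.toReal_pos h0 h1
  have hl := Real.log_le_sub_one_of_pos hp
  rw [ENNReal.log_pos_real h0 h1, ← EReal.coe_neg, EReal.toENNReal_of_ne_top (by simp),
    EReal.toENNReal_of_ne_top (by simp), EReal.toReal_coe, EReal.toReal_coe]
  nth_rewrite 2 [← ENNReal.ofReal_toReal h1]
  rw [← ENNReal.ofReal_one]
  rcases le_total 0 (Real.log t.toReal) with h | h
  · rw [ENNReal.ofReal_of_nonpos (by linarith), zero_add, ← ENNReal.ofReal_add h zero_le_one,
      ← ENNReal.ofReal_add (by linarith) (by linarith)]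
    congr 1; ring
  · rw [ENNReal.ofReal_of_nonpos h, zero_add, ← ENNReal.ofReal_add (by linarith) hp.le,
      ← ENNReal.ofReal_add (by linarith) zero_le_one]
    congr 1; ring

theorem ENNReal.toENNReal_log_le (t : ℝ≥0∞) : (ENNReal.log t).toENNReal ≤ t := by
  rcases eq_or_ne t 0 with rfl | h0
  · simp
  rcases eq_or_ne t ∞ with rfl | h1
  · simp
  have hp : 0 < t.toReal := ENNReal.toReal_pos h0 h1
  rw [ENNReal.log_pos_real h0 h1, EReal.toENNReal_of_ne_top (by simp), EReal.toReal_coe]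
  exact ENNReal.ofReal_le_of_le_toReal ((Real.log_le_sub_one_of_pos hp).trans (by linarith))

variable {X Y : Type*} [MeasurableSpace X] [MeasurableSpace Y]

/-- The density of `η` with respect to `f η` is `1/f`, and `f · klFun (1/f) = f - 1 - log f`. -/
theorem InformationTheory.klDiv_withDensity {η : Measure X} [IsFiniteMeasure η] {f : X → ℝ≥0∞}
    (hf : Measurable f) (h0 : ∀ᵐ x ∂η, f x ≠ 0) (hi : ∫⁻ x, f x ∂η ≠ ∞) :
    klDiv η (η.withDensity f)
      = ∫⁻ x, ENNReal.ofReal ((f x).toReal - 1 - Real.log (f x).toReal) ∂η := by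
  have : IsFiniteMeasure (η.withDensity f) := isFiniteMeasure_withDensity hi
  have h1 : ∀ᵐ x ∂η, f x ≠ ∞ := (ae_lt_top hf hi).mono fun x hx => hx.ne
  have hac : η.withDensity f ≪ η := withDensity_absolutelyContinuous _ _
  have hac' : η ≪ η.withDensity f := withDensity_absolutelyContinuous' hf.aemeasurable h0
  have hd : η.rnDeriv (η.withDensity f) =ᵐ[η] fun x => (f x)⁻¹ := by
    filter_upwards [Measure.rnDeriv_withDensity_right η η hf.aemeasurable h0 h1,
      Measure.rnDeriv_self η] with x hx hx'
    rw [hx, hx', mul_one]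
  rw [klDiv_eq_lintegral_klFun_of_ac hac', lintegral_withDensity_eq_lintegral_mul _ hf
    (by fun_prop)]
  refine lintegral_congr_ae ?_
  filter_upwards [hd, h0, h1] with x hx hx0 hx1
  have hp : 0 < (f x).toReal := ENNReal.toReal_pos hx0 hx1
  rw [Pi.mul_apply, hx, ENNReal.toReal_inv, klFun]
  nth_rewrite 1 [← ENNReal.ofReal_toReal hx1]
  rw [← ENNReal.ofReal_mul hp.le, Real.log_inv]
  congr 1
  field_simp
  ring

/-- The equality case of data processing: when the density factors through `β`, both divergences
integrate the same function of `f`. -/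
theorem InformationTheory.klDiv_withDensity_comp {θ : Measure Y} [IsFiniteMeasure θ] {β : Y → X}
    (hβ : Measurable β) {f : X → ℝ≥0∞} (hf : Measurable f) (h0 : ∀ᵐ x ∂(θ.map β), f x ≠ 0)
    (hi : ∫⁻ x, f x ∂(θ.map β) ≠ ∞) :
    klDiv θ (θ.withDensity (f ∘ β)) = klDiv (θ.map β) ((θ.map β).withDensity f) := by
  rw [klDiv_withDensity hf h0 hi, klDiv_withDensity (hf.comp hβ)
    (ae_of_ae_map hβ.aemeasurable h0) (by rwa [lintegral_map hf hβ] at hi)]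
  rw [lintegral_map (by fun_prop) hβ]
  rfl

theorem InformationTheory.klDiv_eq_lintegral_rnDeriv {η η' : Measure X} [IsProbabilityMeasure η]
    [IsProbabilityMeasure η'] (h : η ≪ η') (h' : η' ≪ η) :
    ∫⁻ x, (-ENNReal.log (η'.rnDeriv η x)).toENNReal ∂η
      = klDiv η η' + ∫⁻ x, (ENNReal.log (η'.rnDeriv η x)).toENNReal ∂η := by
  have hpos : ∀ᵐ x ∂η, η'.rnDeriv η x ≠ 0 := (Measure.rnDeriv_pos' h).mono fun x hx => hx.ne'
  have hint : ∫⁻ x, η'.rnDeriv η x ∂η = 1 := by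
    rw [Measure.lintegral_rnDeriv h', measure_univ]
  have hm := Measure.measurable_rnDeriv η' η
  have hkl : klDiv η η' = _ := (congrArg (klDiv η) (Measure.withDensity_rnDeriv_eq η' η h')).symm.trans
    (klDiv_withDensity hm hpos (by simp [hint]))
  have hadd : ∫⁻ x, ((-ENNReal.log (η'.rnDeriv η x)).toENNReal + η'.rnDeriv η x) ∂η
      = ∫⁻ x, (ENNReal.ofReal ((η'.rnDeriv η x).toReal - 1 - Real.log (η'.rnDeriv η x).toReal)
        + ((ENNReal.log (η'.rnDeriv η x)).toENNReal + 1)) ∂η := by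
    refine lintegral_congr_ae ?_
    filter_upwards [hpos, Measure.rnDeriv_ne_top η' η] with x hx hx'
    exact ENNReal.toENNReal_neg_log_add hx hx'
  rw [lintegral_add_right _ hm, lintegral_add_left (by fun_prop), lintegral_add_right _ (by fun_prop),
    hint, ← hkl, lintegral_one, measure_univ, ← add_assoc] at hadd
  exact (ENNReal.add_left_inj ENNReal.one_ne_top).1 hadd

theorem IRSWalk.furstenbergEntropy_eq_lintegral_klDiv {G : Type*} [Group G] [MeasurableSpace G]
    [Countable G] [DiscreteMeasurableSpace G] [MulAction G X] (μ : Measure G)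
    [IsProbabilityMeasure μ] (η : Measure X) [IsProbabilityMeasure η]
    (hm : ∀ g : G, Measurable fun x : X => g • x)
    (h : ∀ g : G, η ≪ η.map fun x => g • x) (h' : ∀ g : G, (η.map fun x => g • x) ≪ η) :
    furstenbergEntropy μ η = ((∫⁻ g, klDiv η (η.map fun x => g⁻¹ • x) ∂μ : ℝ≥0∞) : EReal) := by
  have hp : ∀ g : G, IsProbabilityMeasure (η.map fun x => g • x) := fun g =>
    Measure.isProbabilityMeasure_map (hm g).aemeasurable
  unfold furstenbergEntropy
  simp_rw [fun g : G => klDiv_eq_lintegral_rnDeriv (h g⁻¹) (h' g⁻¹)]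
  rw [lintegral_add_left .of_discrete, EReal.coe_ennreal_add]
  -- Since `log⁺ t ≤ t` and the density has total mass at most `1`, the subtracted term is finite
  -- and cancels in `EReal`.
  have hfin : ∫⁻ g, ∫⁻ x, (ENNReal.log ((η.map fun y => g⁻¹ • y).rnDeriv η x)).toENNReal ∂η ∂μ
      ≠ ∞ := by
    refine ne_top_of_le_ne_top ENNReal.one_ne_top ?_
    calc _ ≤ ∫⁻ _ : G, 1 ∂μ := lintegral_mono fun g => by
          refine (lintegral_mono fun x => ENNReal.toENNReal_log_le _).trans ?_
          exact Measure.lintegral_rnDeriv_le.trans_eq (measure_univ)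
      _ = 1 := by simp
  lift (∫⁻ g, ∫⁻ x, (ENNReal.log ((η.map fun y => g⁻¹ • y).rnDeriv η x)).toENNReal ∂η ∂μ) to
    NNReal using hfin with b
  exact EReal.add_sub_cancel_right (b := (b : ℝ))

end Divergence

namespace IRSWalk

universe u

/-! ### Measurability in the space of subgroups -/

section Measurability

variable {G : Type u} [Group G]

theorem measurable_subgroup_iff {α : Type*} [MeasurableSpace α] {f : α → Subgroup G} :
    Measurable f ↔ ∀ g, Measurable fun a => g ∈ f a :=
  measurable_comap_iff.trans measurable_set_iff

theorem _root_.Measurable.mem_subgroup {α : Type*} [MeasurableSpace α] {f : α → Subgroup G}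
    (hf : Measurable f) (g : G) : Measurable fun a => g ∈ f a :=
  measurable_subgroup_iff.1 hf g

theorem _root_.Measurable.mem_subgroup' {α : Type*} [MeasurableSpace α] [Countable G]
    [MeasurableSpace G] [DiscreteMeasurableSpace G] {f : α → Subgroup G} (hf : Measurable f)
    {w : α → G} (hw : Measurable w) : Measurable fun a => w a ∈ f a := by
  have : (fun a => w a ∈ f a) = fun a => ∃ g, w a = g ∧ g ∈ f a := by
    funext a
    simp
  rw [this]
  refine Measurable.exists fun g => Measurable.and ?_ (hf.mem_subgroup g)
  exact measurableSet_setOfPred.1 (hw (measurableSet_singleton g))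

theorem measurable_conjSubgroup (γ : G) : Measurable (conjSubgroup (G := G) γ) :=
  measurable_subgroup_iff.2 fun g => by
    simpa only [mem_conjSubgroup, id] using measurable_id.mem_subgroup (γ⁻¹ * g * γ)

/-- Being a subgroup is a countable conjunction of membership conditions, hence a Borel condition on
subsets of `G`. Standardness supplies the conditional law of `K₂` given `K₁`. -/
instance [Countable G] : StandardBorelSpace (Subgroup G) := by
  have hr : MeasurableSet (Set.range fun K : Subgroup G => (K : Set G)) := by
    have : (Set.range fun K : Subgroup G => (K : Set G))
        = {s | 1 ∈ s ∧ (∀ x y, x ∈ s → y ∈ s → x * y ∈ s) ∧ ∀ x, x ∈ s → x⁻¹ ∈ s} := by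
      ext s
      constructor
      · rintro ⟨K, rfl⟩
        exact ⟨K.one_mem, fun _ _ => K.mul_mem, fun _ => K.inv_mem⟩
      · rintro ⟨h1, hm, hi⟩
        exact ⟨⟨⟨⟨s, fun {x y} => hm x y⟩, h1⟩, fun {x} => hi x⟩, rfl⟩
    rw [this]
    have hmem : ∀ x : G, Measurable fun s : Set G => x ∈ s :=
      fun x => measurable_set_iff.1 measurable_id x
    refine measurableSet_setOfPred.2 ((hmem 1).and (Measurable.and ?_ ?_))
    · exact Measurable.forall fun x => Measurable.forall fun y =>
        (hmem x).imp ((hmem y).imp (hmem (x * y)))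
    · exact Measurable.forall fun x => (hmem x).imp (hmem x⁻¹)
  have : StandardBorelSpace (Set G) := inferInstanceAs (StandardBorelSpace (G → Prop))
  obtain ⟨τ, hb, hp⟩ := hr.standardBorel.polish
  let e : Subgroup G ≃ Set.range fun K : Subgroup G => (K : Set G) :=
    Equiv.ofInjective _ SetLike.coe_injective
  let : TopologicalSpace (Subgroup G) := TopologicalSpace.induced e inferInstance
  refine ⟨⟨inferInstance, ⟨?_⟩, e.polishSpace_induced⟩⟩
  refine Eq.trans ?_ (borel_comap (f := e)).symm
  rw [← BorelSpace.measurable_eq]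
  change _ = MeasurableSpace.comap e (MeasurableSpace.comap Subtype.val _)
  rw [MeasurableSpace.comap_comp]
  rfl

theorem mem_rightCoset {K : Subgroup G} {g x : G} : x ∈ rightCoset K g ↔ x * g⁻¹ ∈ K := by
  constructor
  · rintro ⟨k, hk, rfl⟩
    simpa using hk
  · intro h
    exact ⟨_, h, by simp⟩

theorem rightCoset_eq_iff {K : Subgroup G} {g h : G} :
    rightCoset K g = rightCoset K h ↔ g * h⁻¹ ∈ K := by
  constructor
  · intro e
    rw [← mem_rightCoset, ← e, mem_rightCoset]
    simp
  · intro e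
    ext x
    rw [mem_rightCoset, mem_rightCoset, ← K.mul_mem_cancel_right e]
    simp [mul_assoc]

variable {α : Type*} [MeasurableSpace α]

theorem measurable_cosetPath_iff {f : α → CosetPath G} :
    Measurable f ↔ (∀ g, Measurable fun a => g ∈ (f a).1.1) ∧
      ∀ n g, Measurable fun a => g ∈ (f a).1.2 n := by
  rw [measurable_comap_iff]
  refine measurable_fun_prod.trans (and_congr measurable_subgroup_iff ?_)
  exact measurable_pi_iff.trans (forall_congr' fun n => measurable_set_iff)

end Measurability

/-- The first coordinate of an i.i.d. sequence is independent of the others. -/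
theorem map_cons_infinitePi {G : Type*} [MeasurableSpace G] (μ : Measure G) [IsProbabilityMeasure μ] :
    (Measure.infinitePi fun _ : ℕ => μ).map (fun x => (x 0, fun k => x (k + 1)))
      = μ.prod (Measure.infinitePi fun _ : ℕ => μ) := by
  have hcons : Measurable fun p : G × (ℕ → G) => (fun n => Nat.casesOn n p.1 p.2 : ℕ → G) :=
    measurable_pi_iff.2 fun n => by
      cases n with
      | zero => exact measurable_fst
      | succ n => exact (measurable_pi_apply n).comp measurable_snd
  have hsplit : Measurable fun x : ℕ → G => (x 0, fun k => x (k + 1)) := by fun_prop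
  have key : (μ.prod (Measure.infinitePi fun _ : ℕ => μ)).map
      (fun p => (fun n => Nat.casesOn n p.1 p.2 : ℕ → G)) = Measure.infinitePi fun _ : ℕ => μ := by
    refine Measure.eq_infinitePi _ fun s t ht => ?_
    classical
    obtain ⟨N, hN⟩ := s.exists_nat_subset_range
    -- The box is padded to a full initial segment that contains index `0`, so that the first
    -- coordinate can be split off.
    let u : ℕ → Set G := fun i => if i ∈ s then t i else Set.univ
    have hu : ∀ i, MeasurableSet (u i) := fun i => by
      by_cases h : i ∈ s <;> simp [u, h, ht]
    have hbox : Set.pi (s : Set ℕ) t = Set.pi (Finset.range (N + 1) : Set ℕ) u := by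
      ext x
      constructor
      · intro hx i _
        by_cases h : i ∈ s
        · simpa [u, h] using hx i h
        · simp [u, h]
      · intro hx i hi
        have := hx i (Finset.mem_coe.2 (Finset.range_mono N.le_succ (hN hi)))
        simpa [u, Finset.mem_coe.1 hi] using this
    have hprod : ∏ i ∈ s, μ (t i) = ∏ i ∈ Finset.range (N + 1), μ (u i) := by
      refine (Finset.prod_congr rfl fun i hi => by simp [u, hi]).trans
        (Finset.prod_subset (hN.trans (Finset.range_mono N.le_succ)) fun i _ hi => by simp [u, hi])
    have hpre : (fun p : G × (ℕ → G) => (fun n => Nat.casesOn n p.1 p.2 : ℕ → G)) ⁻¹'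
        (Set.pi (Finset.range (N + 1) : Set ℕ) u)
        = u 0 ×ˢ Set.pi (Finset.range N : Set ℕ) fun i => u (i + 1) := by
      ext p
      constructor
      · intro hp
        exact ⟨hp 0 (by simp), fun i hi => hp (i + 1) (by simpa using hi)⟩
      · rintro ⟨h0, h1⟩ i hi
        cases i with
        | zero => exact h0
        | succ i => exact h1 i (by simpa using hi)
    rw [hbox, hprod, Measure.map_apply hcons (.pi (Finset.countable_toSet _) fun i _ => hu i), hpre,
      Measure.prod_prod, Measure.infinitePi_pi _ fun i _ => hu _, Finset.prod_range_succ', mul_comm]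
  nth_rewrite 1 [← key]
  rw [Measure.map_map hsplit hcons]
  exact Measure.map_id

/-! ### The walk on cosets started away from the root -/

section Walk

variable {G : Type u} [Group G]

/-- The path `(K; K γ Z₀, K γ Z₁, …)` for the walk `Z` with given increments. -/
def cosetWalkFrom (γ : G) (q : Subgroup G × (ℕ → G)) : CosetPath G :=
  ⟨(q.1, fun n => rightCoset q.1 (γ * walk q.2 n)), fun n => ⟨γ * walk q.2 n, rfl⟩⟩

theorem cosetWalkFrom_one : cosetWalkFrom (1 : G) = cosetWalk := by
  funext q
  simp [cosetWalkFrom, cosetWalk]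

theorem translate_cosetWalkFrom (γ δ : G) (q : Subgroup G × (ℕ → G)) :
    translate γ (cosetWalkFrom δ q) = cosetWalkFrom (γ * δ) (conjSubgroup γ q.1, q.2) := by
  simp only [translate, cosetWalkFrom, image_rightCoset, mul_assoc]

theorem walk_succ (x : ℕ → G) (n : ℕ) : walk x (n + 1) = x 0 * walk (fun k => x (k + 1)) n := by
  induction n with
  | zero => simp [walk]
  | succ n ih => rw [walk, ih, walk, mul_assoc]

theorem shift_cosetWalkFrom (γ : G) (K : Subgroup G) (x : ℕ → G) :
    shift (cosetWalkFrom γ (K, x)) = cosetWalkFrom (γ * x 0) (K, fun k => x (k + 1)) := by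
  simp [shift, cosetWalkFrom, walk_succ, mul_assoc]

/-- The path of cosets of `L` that is covered by a path of cosets of a subgroup of `L`. -/
def pushPath (L : Subgroup G) (c : CosetPath G) : CosetPath G :=
  -- When the subgroup of the path is not contained in `L`, the default is the constant path at the
  -- coset `L`; it keeps the map total, measurable and compatible with the shift.
  ⟨(L, fun n => {x | (c.1.1 ≤ L ∧ ∃ k ∈ L, ∃ y ∈ c.1.2 n, x = k * y) ∨ (¬ c.1.1 ≤ L ∧ x ∈ L)}), by
    intro n
    obtain ⟨g, hg⟩ := c.2 n
    by_cases h : c.1.1 ≤ L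
    · refine ⟨g, ?_⟩
      ext x
      simp only [h, hg, true_and, not_true, false_and, or_false, Set.mem_ofPred_eq]
      constructor
      · rintro ⟨k, hk, _, ⟨l, hl, rfl⟩, rfl⟩
        exact ⟨k * l, L.mul_mem hk (h hl), by simp [mul_assoc]⟩
      · rintro ⟨k, hk, rfl⟩
        exact ⟨k, hk, g, ⟨1, one_mem _, by simp⟩, rfl⟩
    · refine ⟨1, ?_⟩
      ext x
      simp [h, mem_rightCoset]⟩

theorem pushPath_shift (L : Subgroup G) (c : CosetPath G) :
    pushPath L (shift c) = shift (pushPath L c) := rfl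

theorem pushPath_cosetWalkFrom {K L : Subgroup G} (h : K ≤ L) (γ : G) (x : ℕ → G) :
    pushPath L (cosetWalkFrom γ (K, x)) = cosetWalkFrom γ (L, x) := by
  refine Subtype.ext (Prod.ext rfl (funext fun n => ?_))
  ext y
  simp only [pushPath, cosetWalkFrom, h, true_and, not_true, false_and, or_false,
    Set.mem_ofPred_eq]
  constructor
  · rintro ⟨k, hk, _, ⟨l, hl, rfl⟩, rfl⟩
    exact ⟨k * l, L.mul_mem hk (h hl), by simp [mul_assoc]⟩
  · rintro ⟨k, hk, rfl⟩
    exact ⟨k, hk, _, ⟨1, one_mem _, by simp⟩, rfl⟩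

theorem measurable_pushPath [Countable G] :
    Measurable fun p : Subgroup G × CosetPath G => pushPath p.1 p.2 := by
  have hL : ∀ g : G, Measurable fun p : Subgroup G × CosetPath G => g ∈ p.1 :=
    fun g => measurable_fst.mem_subgroup g
  obtain ⟨hK, hc⟩ := measurable_cosetPath_iff.1
    (measurable_snd : Measurable (Prod.snd : Subgroup G × CosetPath G → CosetPath G))
  have hle : Measurable fun p : Subgroup G × CosetPath G => p.2.1.1 ≤ p.1 :=
    Measurable.forall fun g => (hK g).imp (hL g)
  refine measurable_cosetPath_iff.2 ⟨hL, fun n g => ?_⟩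
  refine (hle.and ?_).or (hle.not.and (hL g))
  exact Measurable.exists fun k => (hL k).and <| Measurable.exists fun y =>
    (hc n y).and measurable_const

variable [MeasurableSpace G]

/-- The law of `(K; K γ Z₀, K γ Z₁, …)`. -/
noncomputable def cosetWalkLawFrom (γ : G) (μ : Measure G) (lam : Measure (Subgroup G)) :
    Measure (CosetPath G) :=
  (lam.prod (Measure.infinitePi fun _ : ℕ => μ)).map (cosetWalkFrom γ)

theorem cosetWalkLawFrom_one (μ : Measure G) (lam : Measure (Subgroup G)) :
    cosetWalkLawFrom 1 μ lam = cosetWalkLaw μ lam := by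
  rw [cosetWalkLawFrom, cosetWalkFrom_one, cosetWalkLaw]

variable [Countable G] [DiscreteMeasurableSpace G]

theorem measurable_walk (n : ℕ) : Measurable fun x : ℕ → G => walk x n := by
  induction n with
  | zero => exact measurable_const
  | succ n ih =>
    exact (Measurable.of_discrete (f := fun p : G × G => p.1 * p.2)).comp
      (ih.prodMk (measurable_pi_apply n))

theorem measurable_cosetWalkFrom (γ : G) : Measurable (cosetWalkFrom γ) := by
  refine measurable_cosetPath_iff.2 ⟨fun g => measurable_fst.mem_subgroup g, fun n g => ?_⟩
  simp only [cosetWalkFrom, mem_rightCoset]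
  refine measurable_fst.mem_subgroup' ?_
  exact (Measurable.of_discrete (f := fun w : G => g * (γ * w)⁻¹)).comp
    ((measurable_walk n).comp measurable_snd)

instance (γ : G) (μ : Measure G) [IsProbabilityMeasure μ] (lam : Measure (Subgroup G))
    [IsProbabilityMeasure lam] : IsProbabilityMeasure (cosetWalkLawFrom γ μ lam) :=
  Measure.isProbabilityMeasure_map (measurable_cosetWalkFrom γ).aemeasurable

/-- Translation by `γ` conjugates the random subgroup, which preserves its law, and moves the
starting coset to that of `γ`. -/
theorem map_translate_cosetWalkLaw (γ : G) (μ : Measure G) [IsProbabilityMeasure μ]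
    {lam : Measure (Subgroup G)} [IsProbabilityMeasure lam]
    (hinv : lam.map (conjSubgroup γ) = lam) :
    (cosetWalkLaw μ lam).map (translate γ) = cosetWalkLawFrom γ μ lam := by
  rw [← cosetWalkLawFrom_one, cosetWalkLawFrom,
    Measure.map_map (measurable_translate γ) (measurable_cosetWalkFrom 1)]
  have : translate γ ∘ cosetWalkFrom 1
      = cosetWalkFrom γ ∘ Prod.map (conjSubgroup γ) (id : (ℕ → G) → ℕ → G) := by
    funext q
    simp only [Function.comp_apply, translate_cosetWalkFrom, mul_one]
    rfl
  rw [this, ← Measure.map_map (measurable_cosetWalkFrom γ)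
    ((measurable_conjSubgroup γ).prodMap measurable_id),
    ← Measure.map_prod_map _ _ (measurable_conjSubgroup γ) measurable_id, hinv, Measure.map_id,
    cosetWalkLawFrom]

/-- Harmonicity: an invariant event does not see time zero, and after a first step `s` the walk is a
fresh one started at `γ s`. -/
theorem cosetWalkLawFrom_apply_eq_lintegral (γ : G) (μ : Measure G) [IsProbabilityMeasure μ]
    (lam : Measure (Subgroup G)) [IsProbabilityMeasure lam] {A : Set (CosetPath G)}
    (hA : MeasurableSet[MeasurableSpace.invariants shift] A) :
    cosetWalkLawFrom γ μ lam A = ∫⁻ s, cosetWalkLawFrom (γ * s) μ lam A ∂μ := by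
  have hm := measurable_cosetWalkFrom (G := G)
  set φ : G × (ℕ → G) → ℝ≥0∞ := fun p => lam {K | cosetWalkFrom (γ * p.1) (K, p.2) ∈ A} with hφ
  have hφm : Measurable φ := measurable_from_prod_countable_right fun s =>
    measurable_measure_prodMk_right (hm (γ * s) hA.1)
  have hsh : ∀ x : ℕ → G, lam ((fun K => (K, x)) ⁻¹' (cosetWalkFrom γ ⁻¹' A))
      = φ (x 0, fun k => x (k + 1)) := fun x => by
    congr 1
    ext K
    have := Set.ext_iff.1 hA.2 (cosetWalkFrom γ (K, x))
    rw [Set.mem_preimage, shift_cosetWalkFrom] at this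
    exact this.symm
  rw [cosetWalkLawFrom, Measure.map_apply (hm γ) hA.1, Measure.prod_apply_symm (hm γ hA.1)]
  simp_rw [hsh]
  rw [← lintegral_map (f := φ) (g := fun x : ℕ → G => (x 0, fun k => x (k + 1))) hφm (by fun_prop),
    map_cons_infinitePi, lintegral_prod _ hφm.aemeasurable]
  refine lintegral_congr fun s => ?_
  rw [cosetWalkLawFrom, Measure.map_apply (hm _) hA.1, Measure.prod_apply_symm (hm _ hA.1)]
  rfl

/-- By harmonicity, nullity passes from `γ` to `γ s` for each `s` of positive mass; since these `s`
generate `G` as a semigroup, it reaches every starting point. -/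
theorem cosetWalkLawFrom_eq_zero {μ : Measure G} [IsProbabilityMeasure μ] (hμ : IsAdmissible μ)
    {lam : Measure (Subgroup G)} [IsProbabilityMeasure lam] {A : Set (CosetPath G)}
    (hA : MeasurableSet[MeasurableSpace.invariants shift] A) {γ : G}
    (h : cosetWalkLawFrom γ μ lam A = 0) (δ : G) : cosetWalkLawFrom δ μ lam A = 0 := by
  suffices ∀ s γ, cosetWalkLawFrom γ μ lam A = 0 → cosetWalkLawFrom (γ * s) μ lam A = 0 by
    simpa using this (γ⁻¹ * δ) γ h
  intro s
  have hs : s ∈ Subsemigroup.closure {g : G | μ {g} ≠ 0} := by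
    rw [hμ]
    trivial
  induction hs using Subsemigroup.closure_induction with
  | mem s hs =>
    intro γ hγ
    rw [cosetWalkLawFrom_apply_eq_lintegral γ μ lam hA, lintegral_eq_zero_iff .of_discrete] at hγ
    by_contra h0
    refine hs (measure_mono_null ?_ (ae_iff.1 hγ))
    simpa using h0
  | mul s t _ _ hs ht =>
    intro γ hγ
    rw [← mul_assoc]
    exact ht _ (hs _ hγ)

end Walk

/-! ### The harmonic measure and its translates -/

section Boundary

open InformationTheory

variable {G : Type u} [Group G] [MeasurableSpace G] {μ : Measure G} {lam : Measure (Subgroup G)}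

namespace PoissonBoundary

theorem measurable_bnd' (B : PoissonBoundary μ lam) : Measurable B.bnd :=
  B.measurable_bnd.mono (MeasurableSpace.invariants_le _) le_rfl

theorem harmonicMeasure_eq (B : PoissonBoundary μ lam) :
    B.harmonicMeasure = (cosetWalkLawFrom 1 μ lam).map B.bnd := by
  rw [cosetWalkLawFrom_one, harmonicMeasure]

variable [Countable G] [DiscreteMeasurableSpace G] [IsProbabilityMeasure μ]
  [IsProbabilityMeasure lam]

instance (B : PoissonBoundary μ lam) : IsProbabilityMeasure B.harmonicMeasure := by
  rw [harmonicMeasure_eq]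
  exact Measure.isProbabilityMeasure_map B.measurable_bnd'.aemeasurable

theorem map_smul_harmonicMeasure (B : PoissonBoundary μ lam) {γ : G}
    (hinv : lam.map (conjSubgroup γ) = lam) :
    B.harmonicMeasure.map (fun b => γ • b) = (cosetWalkLawFrom γ μ lam).map B.bnd := by
  rw [harmonicMeasure, Measure.map_map (B.measurable_action γ) B.measurable_bnd',
    ← map_translate_cosetWalkLaw γ μ hinv, Measure.map_map B.measurable_bnd' (measurable_translate γ)]
  exact Measure.map_congr ((B.equivariant γ).mono fun c hc => hc.symm)

theorem absolutelyContinuous (hμ : IsAdmissible μ) (B : PoissonBoundary μ lam) (γ δ : G) :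
    (cosetWalkLawFrom γ μ lam).map B.bnd ≪ (cosetWalkLawFrom δ μ lam).map B.bnd := by
  refine Measure.AbsolutelyContinuous.mk fun E hE h => ?_
  rw [Measure.map_apply B.measurable_bnd' hE] at h ⊢
  exact cosetWalkLawFrom_eq_zero hμ (B.measurable_bnd hE) h γ

theorem entropy_eq_lintegral_klDiv (hμ : IsAdmissible μ) (B : PoissonBoundary μ lam)
    (hinv : ∀ γ : G, lam.map (conjSubgroup γ) = lam) :
    B.entropy = ((∫⁻ g, klDiv ((cosetWalkLawFrom 1 μ lam).map B.bnd)
      ((cosetWalkLawFrom g⁻¹ μ lam).map B.bnd) ∂μ : ℝ≥0∞) : EReal) := by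
  have h := fun γ : G => B.map_smul_harmonicMeasure (hinv γ)
  rw [entropy, furstenbergEntropy_eq_lintegral_klDiv μ _ B.measurable_action]
  · simp_rw [h, harmonicMeasure_eq]
  · intro g
    rw [h, harmonicMeasure_eq]
    exact B.absolutelyContinuous hμ 1 g
  · intro g
    rw [h, harmonicMeasure_eq]
    exact B.absolutelyContinuous hμ g 1

/-- The density of a translate of the harmonic measure is a density on the σ-algebra of
shift-invariant sets. -/
theorem lintegral_cosetWalkLawFrom (hμ : IsAdmissible μ) (B : PoissonBoundary μ lam) (γ : G)
    {u : CosetPath G → ℝ≥0∞} (hu : Measurable[MeasurableSpace.invariants shift] u) :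
    ∫⁻ c, u c ∂(cosetWalkLawFrom γ μ lam)
      = ∫⁻ c, u c * ((cosetWalkLawFrom γ μ lam).map B.bnd).rnDeriv
          ((cosetWalkLawFrom 1 μ lam).map B.bnd) (B.bnd c) ∂(cosetWalkLawFrom 1 μ lam) := by
  set P := cosetWalkLawFrom 1 μ lam
  set Q := cosetWalkLawFrom γ μ lam
  set f := (Q.map B.bnd).rnDeriv (P.map B.bnd)
  have hm := MeasurableSpace.invariants_le (shift (G := G))
  have hfb : Measurable (f ∘ B.bnd) := (Measure.measurable_rnDeriv _ _).comp B.measurable_bnd'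
  have htrim : Q.trim hm = (P.withDensity (f ∘ B.bnd)).trim hm := by
    refine @Measure.ext _ (MeasurableSpace.invariants shift) _ _ fun A hA => ?_
    rw [trim_measurableSet_eq hm hA, trim_measurableSet_eq hm hA]
    obtain ⟨E, hE, hEA⟩ := B.generates A hA
    rw [← cosetWalkLawFrom_one] at hEA
    -- The set `E` represents `A` only up to a null set for the start at `1`. The difference is an
    -- invariant set, so it is also null for the start at `γ`.
    have hEA' : B.bnd ⁻¹' E =ᵐ[Q] A := by
      have := measure_symmDiff_eq_zero_iff.2 hEA
      exact measure_symmDiff_eq_zero_iff.1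
        (cosetWalkLawFrom_eq_zero hμ ((B.measurable_bnd hE).symmDiff hA) this γ)
    rw [← measure_congr hEA',
      ← measure_congr ((withDensity_absolutelyContinuous P (f ∘ B.bnd)).ae_eq hEA),
      ← Measure.map_apply B.measurable_bnd' hE,
      ← Measure.withDensity_rnDeriv_eq _ _ (B.absolutelyContinuous hμ γ 1),
      withDensity_apply _ hE, withDensity_apply _ (B.measurable_bnd' hE),
      setLIntegral_map hE (Measure.measurable_rnDeriv _ _) B.measurable_bnd']
    rfl
  rw [← lintegral_trim hm hu, htrim, lintegral_trim hm hu,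
    lintegral_withDensity_eq_lintegral_mul _ hfb (hu.mono hm le_rfl)]
  exact lintegral_congr fun c => mul_comm _ _

end PoissonBoundary

variable [Countable G] [DiscreteMeasurableSpace G] [IsProbabilityMeasure μ]

/-- Integrating out the larger subgroup of a pair turns an invariant event for its path of cosets
into an invariant function of the path of cosets of the smaller subgroup. -/
theorem exists_invariant_lintegral_eq (ρ : Measure (Subgroup G × Subgroup G))
    [IsProbabilityMeasure ρ] (hle : ∀ᵐ K ∂ρ, K.1 ≤ K.2) {A : Set (CosetPath G)}
    (hA : MeasurableSet[MeasurableSpace.invariants shift] A) :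
    ∃ u : CosetPath G → ℝ≥0∞, Measurable[MeasurableSpace.invariants shift] u ∧
      ∀ (γ : G) (F : CosetPath G → ℝ≥0∞), Measurable F →
        ∫⁻ w in (fun w : (Subgroup G × Subgroup G) × (ℕ → G) =>
            cosetWalkFrom γ (w.1.2, w.2)) ⁻¹' A, F (cosetWalkFrom γ (w.1.1, w.2))
              ∂(ρ.prod (Measure.infinitePi fun _ : ℕ => μ))
          = ∫⁻ c, u c * F c ∂(cosetWalkLawFrom γ μ (ρ.map Prod.fst)) := by
  -- The conditional probability, given `K₁` and its path `c`, that the projected path lies in `A`.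
  -- The increments are independent of the pair, so the law of `K₂` is conditioned on `K₁` alone and
  -- `u` does not involve `γ`.
  set u : CosetPath G → ℝ≥0∞ := fun c => ρ.condKernel c.1.1 {L | pushPath L c ∈ A} with hu
  have hS : MeasurableSet {p : CosetPath G × Subgroup G | pushPath p.2 p.1 ∈ A} :=
    (measurable_pushPath.comp measurable_swap) hA.1
  have hum : Measurable u := by
    have := Kernel.measurable_kernel_prodMk_left (κ := ρ.condKernel.comap
      (fun c : CosetPath G => c.1.1) (measurable_fst.comp measurable_subtype_coe)) hS
    exact this
  refine ⟨u, MeasurableSpace.measurable_invariants_dom.2 ⟨hum, fun s _ => ?_⟩, fun γ F hF => ?_⟩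
  · have : u ∘ shift = u := by
      funext c
      simp only [hu, Function.comp_apply, pushPath_shift]
      congr 1
      ext L
      exact Set.ext_iff.1 hA.2 (pushPath L c)
    rw [this]
  · have hm := measurable_cosetWalkFrom γ
    have hm1 : Measurable fun w : (Subgroup G × Subgroup G) × (ℕ → G) =>
      cosetWalkFrom γ (w.1.1, w.2) := hm.comp (by fun_prop)
    have hm2 : Measurable fun w : (Subgroup G × Subgroup G) × (ℕ → G) =>
      cosetWalkFrom γ (w.1.2, w.2) := hm.comp (by fun_prop)
    have hind : Measurable (A.indicator (1 : CosetPath G → ℝ≥0∞)) := measurable_one.indicator hA.1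
    have hpush : Measurable fun w : (Subgroup G × Subgroup G) × (ℕ → G) =>
        pushPath w.1.2 (cosetWalkFrom γ (w.1.1, w.2)) :=
      measurable_pushPath.comp ((measurable_snd.comp measurable_fst).prodMk hm1)
    -- Almost surely `K₁ ≤ K₂`, where the projected `K₁`-path is the `K₂`-path, so `h` is the
    -- integrand of the left side.
    set h : (Subgroup G × Subgroup G) × (ℕ → G) → ℝ≥0∞ := fun w =>
      A.indicator 1 (pushPath w.1.2 (cosetWalkFrom γ (w.1.1, w.2)))
        * F (cosetWalkFrom γ (w.1.1, w.2)) with hh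
    have hhm : Measurable h := (hind.comp hpush).mul (hF.comp hm1)
    have hle' : ∀ᵐ w ∂(ρ.prod (Measure.infinitePi fun _ : ℕ => μ)), w.1.1 ≤ w.1.2 :=
      Measure.quasiMeasurePreserving_fst.ae hle
    have hinner : ∀ x : ℕ → G, ∫⁻ K, h (K, x) ∂ρ
        = ∫⁻ K, u (cosetWalkFrom γ (K, x)) * F (cosetWalkFrom γ (K, x)) ∂(ρ.map Prod.fst) := by
      intro x
      have hx : Measurable fun K => h (K, x) := hhm.comp measurable_prodMk_right
      conv_lhs => rw [← ρ.disintegrate ρ.condKernel]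
      rw [Measure.lintegral_compProd hx]
      refine lintegral_congr fun K => ?_
      have hi : Measurable fun L => A.indicator (1 : CosetPath G → ℝ≥0∞)
          (pushPath L (cosetWalkFrom γ (K, x))) :=
        hind.comp (measurable_pushPath.comp measurable_prodMk_right)
      simp only [hh]
      rw [lintegral_mul_const _ hi]
      congr 1
      have hT : MeasurableSet {L | pushPath L (cosetWalkFrom γ (K, x)) ∈ A} :=
        (measurable_pushPath.comp measurable_prodMk_right) hA.1
      exact lintegral_indicator_one hT
    have huF : Measurable fun c => u c * F c := hum.mul hF
    have huF' : Measurable fun q : Subgroup G × (ℕ → G) =>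
      u (cosetWalkFrom γ q) * F (cosetWalkFrom γ q) := huF.comp hm
    rw [← lintegral_indicator (hm2 hA.1), lintegral_congr_ae (g := h), lintegral_prod_symm _
      hhm.aemeasurable, cosetWalkLawFrom, lintegral_map huF hm, lintegral_prod_symm _
      huF'.aemeasurable]
    · exact lintegral_congr hinner
    · filter_upwards [hle'] with w hw
      simp only [hh, pushPath_cosetWalkFrom hw]
      by_cases hwA : cosetWalkFrom γ (w.1.2, w.2) ∈ A
      · rw [Set.indicator_of_mem (by exact hwA), Set.indicator_of_mem hwA, Pi.one_apply, one_mul]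
      · rw [Set.indicator_of_notMem (by exact hwA), Set.indicator_of_notMem hwA, zero_mul]

theorem cosetWalkLawFrom_map (μ : Measure G) [IsProbabilityMeasure μ] {X : Type*}
    [MeasurableSpace X] (ρ : Measure X) [IsProbabilityMeasure ρ] {k : X → Subgroup G}
    (hk : Measurable k) (γ : G) :
    cosetWalkLawFrom γ μ (ρ.map k) = (ρ.prod (Measure.infinitePi fun _ : ℕ => μ)).map
      fun w => cosetWalkFrom γ (k w.1, w.2) := by
  have h := Measure.map_prod_map ρ (Measure.infinitePi fun _ : ℕ => μ) hk measurable_id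
  rw [Measure.map_id] at h
  rw [cosetWalkLawFrom, h, Measure.map_map (measurable_cosetWalkFrom γ) (hk.prodMap measurable_id)]
  rfl

/-- Both harmonic measures and both translates are images of two measures on the coupled space: `θ`,
and `θ` reweighted by the density seen at the first boundary. -/
theorem klDiv_harmonicMeasure_le (hμ : IsAdmissible μ) (ρ : Measure (Subgroup G × Subgroup G))
    [IsProbabilityMeasure ρ] (hle : ∀ᵐ K ∂ρ, K.1 ≤ K.2)
    (B₁ : PoissonBoundary μ (ρ.map Prod.fst)) (B₂ : PoissonBoundary μ (ρ.map Prod.snd)) (γ : G) :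
    klDiv ((cosetWalkLawFrom 1 μ (ρ.map Prod.snd)).map B₂.bnd)
        ((cosetWalkLawFrom γ μ (ρ.map Prod.snd)).map B₂.bnd)
      ≤ klDiv ((cosetWalkLawFrom 1 μ (ρ.map Prod.fst)).map B₁.bnd)
        ((cosetWalkLawFrom γ μ (ρ.map Prod.fst)).map B₁.bnd) := by
  have hp₁ := Measure.isProbabilityMeasure_map (μ := ρ) measurable_fst.aemeasurable
  have hp₂ := Measure.isProbabilityMeasure_map (μ := ρ) measurable_snd.aemeasurable
  have hB₁ := B₁.measurable_bnd'
  have hB₂ := B₂.measurable_bnd'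
  have hprob : ∀ δ : G, IsProbabilityMeasure ((cosetWalkLawFrom δ μ (ρ.map Prod.fst)).map B₁.bnd) :=
    fun δ => Measure.isProbabilityMeasure_map hB₁.aemeasurable
  have hac := B₁.absolutelyContinuous hμ γ 1
  have hac' := B₁.absolutelyContinuous hμ 1 γ
  set θ := ρ.prod (Measure.infinitePi fun _ : ℕ => μ)
  set η := (cosetWalkLawFrom 1 μ (ρ.map Prod.fst)).map B₁.bnd
  set η' := (cosetWalkLawFrom γ μ (ρ.map Prod.fst)).map B₁.bnd
  set f := η'.rnDeriv η
  have hf : Measurable f := Measure.measurable_rnDeriv _ _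
  have hw : ∀ δ : G, Measurable fun w : (Subgroup G × Subgroup G) × (ℕ → G) =>
    cosetWalkFrom δ (w.1.1, w.2) := fun δ => (measurable_cosetWalkFrom δ).comp (by fun_prop)
  have hw' : ∀ δ : G, Measurable fun w : (Subgroup G × Subgroup G) × (ℕ → G) =>
    cosetWalkFrom δ (w.1.2, w.2) := fun δ => (measurable_cosetWalkFrom δ).comp (by fun_prop)
  set β₁ : (Subgroup G × Subgroup G) × (ℕ → G) → B₁.space := fun w =>
    B₁.bnd (cosetWalkFrom 1 (w.1.1, w.2))
  set β₂ : (Subgroup G × Subgroup G) × (ℕ → G) → B₂.space := fun w =>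
    B₂.bnd (cosetWalkFrom 1 (w.1.2, w.2))
  have hβ₁ : Measurable β₁ := hB₁.comp (hw 1)
  have hβ₂ : Measurable β₂ := hB₂.comp (hw' 1)
  have hη : θ.map β₁ = η := by
    simp only [η]
    rw [cosetWalkLawFrom_map μ ρ measurable_fst, Measure.map_map hB₁ (hw 1)]
    rfl
  have hη₂ : (cosetWalkLawFrom 1 μ (ρ.map Prod.snd)).map B₂.bnd = θ.map β₂ := by
    rw [cosetWalkLawFrom_map μ ρ measurable_snd, Measure.map_map hB₂ (hw' 1)]
    rfl
  have hη₂' : (cosetWalkLawFrom γ μ (ρ.map Prod.snd)).map B₂.bnd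
      = (θ.withDensity (f ∘ β₁)).map β₂ := by
    refine Measure.ext fun E hE => ?_
    obtain ⟨u, hu, hint⟩ := exists_invariant_lintegral_eq (μ := μ) ρ hle (B₂.measurable_bnd hE)
    -- The event is expressed through `u` at start `γ` with weight `1`, moved to start `1` at the
    -- cost of the density, and read back with that density as weight.
    have e1 := hint γ 1 measurable_one
    simp only [Pi.one_apply, mul_one, setLIntegral_one] at e1
    rw [B₁.lintegral_cosetWalkLawFrom hμ γ hu] at e1
    replace e1 := e1.trans (hint 1 (f ∘ B₁.bnd) (hf.comp hB₁)).symm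
    rw [Measure.map_apply hB₂ hE, cosetWalkLawFrom_map μ ρ measurable_snd,
      Measure.map_apply (hw' γ) (hB₂ hE), e1, Measure.map_apply hβ₂ hE,
      withDensity_apply _ (hβ₂ hE)]
    rfl
  have hpos : ∀ᵐ x ∂(θ.map β₁), f x ≠ 0 := by
    rw [hη]
    exact (Measure.rnDeriv_pos' hac').mono fun x hx => hx.ne'
  have hint : ∫⁻ x, f x ∂(θ.map β₁) ≠ ∞ := by
    rw [hη, Measure.lintegral_rnDeriv hac]
    exact measure_ne_top _ _
  have : IsFiniteMeasure (θ.withDensity (f ∘ β₁)) :=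
    isFiniteMeasure_withDensity (by rwa [lintegral_map hf hβ₁] at hint)
  calc _ = klDiv (θ.map β₂) ((θ.withDensity (f ∘ β₁)).map β₂) := by rw [hη₂, hη₂']
    _ ≤ klDiv θ (θ.withDensity (f ∘ β₁)) := klDiv_map_le _ _ hβ₂
    _ = klDiv (θ.map β₁) ((θ.map β₁).withDensity f) := klDiv_withDensity_comp hβ₁ hf hpos hint
    _ = klDiv η η' := by rw [hη, Measure.withDensity_rnDeriv_eq _ _ hac]

theorem entropy_le_of_coupling (hμ : IsAdmissible μ) (ρ : Measure (Subgroup G × Subgroup G))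
    [IsProbabilityMeasure ρ] (hle : ∀ᵐ K ∂ρ, K.1 ≤ K.2)
    (hinv : ∀ γ : G, ρ.map (fun K => (conjSubgroup γ K.1, conjSubgroup γ K.2)) = ρ)
    (B₁ : PoissonBoundary μ (ρ.map Prod.fst)) (B₂ : PoissonBoundary μ (ρ.map Prod.snd)) :
    B₂.entropy ≤ B₁.entropy := by
  have := Measure.isProbabilityMeasure_map (μ := ρ) measurable_fst.aemeasurable
  have := Measure.isProbabilityMeasure_map (μ := ρ) measurable_snd.aemeasurable
  have hc : ∀ γ : G, Measurable fun K : Subgroup G × Subgroup G =>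
      (conjSubgroup γ K.1, conjSubgroup γ K.2) := fun γ =>
    ((measurable_conjSubgroup γ).comp measurable_fst).prodMk
      ((measurable_conjSubgroup γ).comp measurable_snd)
  have h1 : ∀ γ : G, (ρ.map Prod.fst).map (conjSubgroup γ) = ρ.map Prod.fst := fun γ => by
    nth_rewrite 2 [← hinv γ]
    rw [Measure.map_map (measurable_conjSubgroup γ) measurable_fst,
      Measure.map_map measurable_fst (hc γ)]
    rfl
  have h2 : ∀ γ : G, (ρ.map Prod.snd).map (conjSubgroup γ) = ρ.map Prod.snd := fun γ => by
    nth_rewrite 2 [← hinv γ]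
    rw [Measure.map_map (measurable_conjSubgroup γ) measurable_snd,
      Measure.map_map measurable_snd (hc γ)]
    rfl
  rw [B₁.entropy_eq_lintegral_klDiv hμ h1, B₂.entropy_eq_lintegral_klDiv hμ h2]
  exact EReal.coe_ennreal_le_coe_ennreal_iff.2
    (lintegral_mono fun g => klDiv_harmonicMeasure_le hμ ρ hle B₁ B₂ g⁻¹)

end Boundary

/-! ### Monotone couplings of random sets -/

section Coupling

/-- A coupling of Bernoulli variables with parameters `q` and `p ≤ q`, the first of which is
implied by the second. -/
noncomputable def bernoulliCoupling (p q : I) : Measure (Prop × Prop) :=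
  unitInterval.toNNReal p • Measure.dirac (True, True)
    + (unitInterval.toNNReal q - unitInterval.toNNReal p) • Measure.dirac (True, False)
    + unitInterval.toNNReal (σ q) • Measure.dirac (False, False)

theorem toNNReal_sub_add_toNNReal_symm {p q : I} (h : p ≤ q) :
    unitInterval.toNNReal q - unitInterval.toNNReal p + unitInterval.toNNReal (σ q)
      = unitInterval.toNNReal (σ p) := by
  have h' : unitInterval.toNNReal p ≤ unitInterval.toNNReal q := h
  apply NNReal.eq
  rw [NNReal.coe_add, NNReal.coe_sub h']
  simp

theorem map_fst_bernoulliCoupling {p q : I} (h : p ≤ q) :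
    (bernoulliCoupling p q).map Prod.fst = unitInterval.toNNReal q • Measure.dirac True
      + unitInterval.toNNReal (σ q) • Measure.dirac False := by
  have h' : unitInterval.toNNReal p ≤ unitInterval.toNNReal q := h
  simp only [bernoulliCoupling]
  rw [Measure.map_add _ _ measurable_fst, Measure.map_add _ _ measurable_fst, Measure.map_smul,
    Measure.map_smul, Measure.map_smul, Measure.map_dirac' measurable_fst,
    Measure.map_dirac' measurable_fst,
    Measure.map_dirac' measurable_fst, ← add_smul, add_tsub_cancel_of_le h']

theorem map_snd_bernoulliCoupling {p q : I} (h : p ≤ q) :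
    (bernoulliCoupling p q).map Prod.snd = unitInterval.toNNReal p • Measure.dirac True
      + unitInterval.toNNReal (σ p) • Measure.dirac False := by
  simp only [bernoulliCoupling]
  rw [Measure.map_add _ _ measurable_snd, Measure.map_add _ _ measurable_snd, Measure.map_smul,
    Measure.map_smul, Measure.map_smul, Measure.map_dirac' measurable_snd,
    Measure.map_dirac' measurable_snd,
    Measure.map_dirac' measurable_snd, add_assoc, ← add_smul, toNNReal_sub_add_toNNReal_symm h]

theorem isProbabilityMeasure_bernoulliCoupling {p q : I} (h : p ≤ q) :
    IsProbabilityMeasure (bernoulliCoupling p q) := by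
  refine (Measure.isProbabilityMeasure_map_iff (f := Prod.fst) measurable_fst.aemeasurable).1 ?_
  rw [map_fst_bernoulliCoupling h]
  infer_instance

theorem bernoulliCoupling_ae_imp (p q : I) : ∀ᵐ x ∂(bernoulliCoupling p q), x.2 → x.1 := by
  rw [ae_iff]
  simp [bernoulliCoupling]

variable {ι : Type*}

theorem map_infinitePi_eq_setBernoulli {m : Measure (Prop × Prop)} [IsProbabilityMeasure m] {p : I}
    {f : Prop × Prop → Prop} (hf : Measurable f) (hm : m.map f
      = unitInterval.toNNReal p • Measure.dirac True + unitInterval.toNNReal (σ p) • Measure.dirac False) :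
    (Measure.infinitePi fun _ : ι => m).map (fun w => {i | f (w i)})
      = setBernoulli (Set.univ : Set ι) p := by
  have h1 : Measurable fun x : ι → Prop => {i | x i} := MeasurableEquiv.setOfPred.measurable
  rw [setBernoulli_eq_map]
  simp only [Set.mem_univ, ← hm]
  rw [← Measure.infinitePi_map_pi _ (fun _ => hf), Measure.map_map h1 (by fun_prop)]
  rfl

end Coupling

/-! ### Measurability of the subgroup of a marked complex -/

section Measurability

/-- Membership in the closure means being the value of one of countably many words in the generators
and their inverses. -/
theorem measurable_closure {G α : Type*} [Group G] [Countable G] [MeasurableSpace α]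
    {S : α → Set G} (hS : ∀ g, Measurable fun a => g ∈ S a) :
    Measurable fun a => Subgroup.closure (S a) := by
  refine measurable_subgroup_iff.2 fun g => ?_
  have : (fun a => g ∈ Subgroup.closure (S a))
      = fun a => ∃ l : List G, (∀ y, y ∈ l → y ∈ S a ∨ y⁻¹ ∈ S a) ∧ l.prod = g := by
    funext a
    refine propext ⟨fun h => Submonoid.exists_list_of_mem_closure (s := S a ∪ (S a)⁻¹)
      (by rwa [← Subgroup.closure_toSubmonoid]), ?_⟩
    rintro ⟨l, hl, rfl⟩
    refine Subgroup.list_prod_mem _ fun y hy => ?_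
    rcases hl y hy with h | h
    · exact Subgroup.subset_closure h
    · exact inv_inv y ▸ Subgroup.inv_mem _ (Subgroup.subset_closure h)
  rw [this]
  exact Measurable.exists fun l => Measurable.and (Measurable.forall fun y =>
    Measurable.imp measurable_const ((hS y).or (hS y⁻¹))) measurable_const

/-- The origin of the edge `edgeAt K g s`. -/
def edgeOrigin (g : F₂) (s : Letter) : F₂ := if s.2 then g else g * s.elt

theorem edgeAt_eq (K : Subgroup F₂) (g : F₂) (s : Letter) :
    edgeAt K g s = (rightCoset K (edgeOrigin g s), s.1) := by
  unfold edgeAt edgeOrigin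
  split_ifs <;> rfl

theorem edgeAt_eq_iff {K : Subgroup F₂} {g : F₂} {s t : Letter} :
    edgeAt K g s = edgeAt K g t
      ↔ edgeOrigin g s * (edgeOrigin g t)⁻¹ ∈ K ∧ s.1 = t.1 := by
  rw [edgeAt_eq, edgeAt_eq, Prod.mk.injEq, rightCoset_eq_iff]

theorem measurable_marked_K : Measurable Marked.K :=
  measurable_fst.comp (comap_measurable (fun x : Marked =>
    (x.K, {q : F₂ × Letter × Letter | x.IsMarked {edgeAt x.K q.1 q.2.1, edgeAt x.K q.1 q.2.2}})))

theorem measurable_isMarked (g : F₂) (s t : Letter) :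
    Measurable fun x : Marked => x.IsMarked {edgeAt x.K g s, edgeAt x.K g t} :=
  measurable_set_iff.1 (measurable_snd.comp (comap_measurable (fun x : Marked =>
    (x.K, {q : F₂ × Letter × Letter | x.IsMarked {edgeAt x.K q.1 q.2.1, edgeAt x.K q.1 q.2.2}}))))
    (g, s, t)

instance : Countable F₂ := inferInstanceAs (Countable (Quot _))

theorem measurable_coverSubgroup : Measurable coverSubgroup := by
  have hK := fun g : F₂ => measurable_marked_K.mem_subgroup g
  refine measurable_closure fun y => Measurable.or ?_ ?_
  · refine Measurable.exists fun g => Measurable.exists fun s => ?_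
    simp only [rightCoset_eq_iff]
    refine (hK _).and (Measurable.and (Measurable.not ?_) measurable_const)
    -- A loop is the degenerate pair of letters `s, s`.
    simpa using measurable_isMarked g s s
  · refine Measurable.exists fun g => Measurable.exists fun s => Measurable.exists fun t => ?_
    simp only [rightCoset_eq_iff, ne_eq, edgeAt_eq_iff]
    exact (hK _).and (((hK _).and measurable_const).not.and
      ((measurable_isMarked g s t).not.and measurable_const))

/-- A pair of letters either bounds a cell, and its event is evaluation of `ω` at that cell, or
bounds none, and its event is empty. -/
theorem measurable_marked_mk (K : Subgroup F₂) : Measurable (Marked.mk K) := by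
  refine measurable_comap_iff.2 (measurable_const.prodMk (measurable_set_iff.2 fun q => ?_))
  change Measurable fun ω : Set (TwoCell K) =>
    ∃ d ∈ ω, d.1 = {edgeAt K q.1 q.2.1, edgeAt K q.1 q.2.2}
  generalize ({edgeAt K q.1 q.2.1, edgeAt K q.1 q.2.2} : Set SchreierEdge) = c
  by_cases hc : IsTwoCell K c
  · have : (fun ω : Set (TwoCell K) => ∃ d ∈ ω, d.1 = c) = fun ω => (⟨c, hc⟩ : TwoCell K) ∈ ω := by
      funext ω
      refine propext ⟨?_, fun h => ⟨_, h, rfl⟩⟩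
      rintro ⟨d, hd, rfl⟩
      exact hd
    rw [this]
    exact measurable_set_iff.1 measurable_id _
  · have : (fun ω : Set (TwoCell K) => ∃ d ∈ ω, d.1 = c) = fun _ => False := by
      funext ω
      refine propext ⟨?_, False.elim⟩
      rintro ⟨d, _, rfl⟩
      exact hc d.2
    rw [this]
    exact measurable_const

/-- The subgroups of the two complexes obtained from a marking of the cells by pairs. -/
noncomputable def coverPair (K : Subgroup F₂) (w : TwoCell K → Prop × Prop) : Subgroup F₂ × Subgroup F₂ :=
  (coverSubgroup ⟨K, {c | (w c).1}⟩, coverSubgroup ⟨K, {c | (w c).2}⟩)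

theorem measurable_coverPair (K : Subgroup F₂) : Measurable (coverPair K) := by
  have h := measurable_coverSubgroup.comp (measurable_marked_mk K)
  refine (h.comp (measurable_set_iff.2 fun c => ?_)).prodMk
    (h.comp (measurable_set_iff.2 fun c => ?_))
  · exact measurable_fst.comp (measurable_pi_apply c)
  · exact measurable_snd.comp (measurable_pi_apply c)

/-- Generators come from unmarked cells, so marking more cells can only remove generators. -/
theorem coverSubgroup_anti {K : Subgroup F₂} {ω ω' : Set (TwoCell K)} (h : ω ⊆ ω') :
    coverSubgroup ⟨K, ω'⟩ ≤ coverSubgroup ⟨K, ω⟩ := by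
  have hm : ∀ c, Marked.IsMarked ⟨K, ω⟩ c → Marked.IsMarked ⟨K, ω'⟩ c := by
    rintro c ⟨d, hd, hdc⟩
    exact ⟨d, h hd, hdc⟩
  refine Subgroup.closure_mono (Set.union_subset_union ?_ ?_)
  · rintro y ⟨g, s, h1, h2, rfl⟩
    exact ⟨g, s, h1, fun h => h2 (hm _ h), rfl⟩
  · rintro y ⟨g, s, t, h1, h2, h3, rfl⟩
    exact ⟨g, s, t, h1, h2, fun h => h3 (hm _ h), rfl⟩

end Measurability

/-! ### Conjugation of marked complexes -/

section Conjugation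

/-- The action of the group on the edges of all Schreier graphs. -/
def moveEdge (γ : F₂) (e : SchreierEdge) : SchreierEdge := ((fun x => γ * x) '' e.1, e.2)

theorem moveEdge_mul (γ δ : F₂) (e : SchreierEdge) :
    moveEdge (γ * δ) e = moveEdge γ (moveEdge δ e) := by
  simp only [moveEdge, Set.image_image, mul_assoc]

theorem moveEdge_one (e : SchreierEdge) : moveEdge 1 e = e := by
  simp [moveEdge]

theorem moveEdge_inv_image (γ : F₂) (c : Set SchreierEdge) :
    moveEdge γ⁻¹ '' (moveEdge γ '' c) = c := by
  simp [Set.image_image, ← moveEdge_mul, moveEdge_one]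

theorem moveEdge_injective (γ : F₂) : Function.Injective (moveEdge γ) :=
  Function.LeftInverse.injective (g := moveEdge γ⁻¹) fun e => by
    rw [← moveEdge_mul, inv_mul_cancel, moveEdge_one]

theorem moveEdge_edgeAt (γ : F₂) (K : Subgroup F₂) (g : F₂) (s : Letter) :
    moveEdge γ (edgeAt K g s) = edgeAt (conjSubgroup γ K) (γ * g) s := by
  unfold edgeAt moveEdge
  split_ifs <;> simp only [image_rightCoset, mul_assoc]

theorem rightCoset_conjSubgroup_eq_iff (γ : F₂) (K : Subgroup F₂) (g h : F₂) :
    rightCoset (conjSubgroup γ K) (γ * g) = rightCoset (conjSubgroup γ K) (γ * h)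
      ↔ rightCoset K g = rightCoset K h := by
  rw [← image_rightCoset, ← image_rightCoset]
  exact Set.image_eq_image (mul_right_injective γ)

theorem IsTwoCell.move {K : Subgroup F₂} {c : Set SchreierEdge} (h : IsTwoCell K c) (γ : F₂) :
    IsTwoCell (conjSubgroup γ K) (moveEdge γ '' c) := by
  cases h with
  | loop g s h =>
    rw [Set.image_singleton, moveEdge_edgeAt]
    refine .loop _ _ ?_
    rwa [mul_assoc, rightCoset_conjSubgroup_eq_iff]
  | bigon g s t h hne =>
    rw [Set.image_pair, moveEdge_edgeAt, moveEdge_edgeAt]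
    refine .bigon _ _ _ ?_ ?_
    · rwa [mul_assoc, mul_assoc, rightCoset_conjSubgroup_eq_iff]
    · rw [← moveEdge_edgeAt, ← moveEdge_edgeAt]
      exact (moveEdge_injective γ).ne hne

theorem conjSubgroup_mul (γ δ : F₂) (K : Subgroup F₂) :
    conjSubgroup (γ * δ) K = conjSubgroup γ (conjSubgroup δ K) := by
  ext x
  simp only [mem_conjSubgroup, mul_inv_rev, mul_assoc]

theorem conjSubgroup_one (K : Subgroup F₂) : conjSubgroup 1 K = K := by
  ext x
  simp [mem_conjSubgroup]

/-- The cell of `X_K` that is moved by `γ` to the given cell. -/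
def unmoveCell (γ : F₂) (K : Subgroup F₂) (c : TwoCell (conjSubgroup γ K)) : TwoCell K :=
  ⟨moveEdge γ⁻¹ '' c.1, by
    have := c.2.move γ⁻¹
    rwa [← conjSubgroup_mul, inv_mul_cancel, conjSubgroup_one] at this⟩

theorem unmoveCell_injective (γ : F₂) (K : Subgroup F₂) : Function.Injective (unmoveCell γ K) := by
  intro c d h
  exact Subtype.ext ((moveEdge_injective γ⁻¹).image_injective (congrArg Subtype.val h))

theorem isMarked_move (γ : F₂) (K : Subgroup F₂) (ω : Set (TwoCell K)) (c : Set SchreierEdge) :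
    Marked.IsMarked ⟨conjSubgroup γ K, unmoveCell γ K ⁻¹' ω⟩ (moveEdge γ '' c)
      ↔ Marked.IsMarked ⟨K, ω⟩ c := by
  constructor
  · rintro ⟨d, hd, hdc⟩
    refine ⟨unmoveCell γ K d, hd, ?_⟩
    change moveEdge γ⁻¹ '' d.1 = c
    rw [hdc, moveEdge_inv_image]
  · rintro ⟨d, hd, rfl⟩
    refine ⟨⟨_, d.2.move γ⟩, ?_, rfl⟩
    have : unmoveCell γ K ⟨_, d.2.move γ⟩ = d := Subtype.ext (moveEdge_inv_image γ d.1)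
    rw [Set.mem_preimage, this]
    exact hd

/-- Left multiplication by `γ` is an isomorphism of labelled complexes from `X_K` to that of the
conjugate, and it conjugates each generator by `γ`. -/
theorem coverSubgroup_move (γ : F₂) (K : Subgroup F₂) (ω : Set (TwoCell K)) :
    coverSubgroup ⟨conjSubgroup γ K, unmoveCell γ K ⁻¹' ω⟩
      = conjSubgroup γ (coverSubgroup ⟨K, ω⟩) := by
  change Subgroup.closure _ = (Subgroup.closure _).map _
  rw [MonoidHom.map_closure, Set.image_union]
  congr 2
  · ext y
    constructor
    · rintro ⟨g, s, h1, h2, rfl⟩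
      obtain ⟨g, rfl⟩ : ∃ g', g = γ * g' := ⟨γ⁻¹ * g, by simp⟩
      refine ⟨_, ⟨g, s, ?_, ?_, rfl⟩, by simp [mul_assoc]⟩
      · rwa [mul_assoc, rightCoset_conjSubgroup_eq_iff] at h1
      · rwa [← moveEdge_edgeAt, ← Set.image_singleton, isMarked_move] at h2
    · rintro ⟨_, ⟨g, s, h1, h2, rfl⟩, rfl⟩
      refine ⟨γ * g, s, ?_, ?_, by simp [mul_assoc]⟩
      · rwa [mul_assoc, rightCoset_conjSubgroup_eq_iff]
      · rwa [← moveEdge_edgeAt, ← Set.image_singleton, isMarked_move]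
  · ext y
    constructor
    · rintro ⟨g, s, t, h1, h2, h3, rfl⟩
      obtain ⟨g, rfl⟩ : ∃ g', g = γ * g' := ⟨γ⁻¹ * g, by simp⟩
      refine ⟨_, ⟨g, s, t, ?_, ?_, ?_, rfl⟩, by simp [mul_assoc]⟩
      · rwa [mul_assoc, mul_assoc, rightCoset_conjSubgroup_eq_iff] at h1
      · rintro h
        exact h2 (by rw [← moveEdge_edgeAt, ← moveEdge_edgeAt, h])
      · rwa [← moveEdge_edgeAt, ← moveEdge_edgeAt, ← Set.image_pair, isMarked_move] at h3
    · rintro ⟨_, ⟨g, s, t, h1, h2, h3, rfl⟩, rfl⟩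
      refine ⟨γ * g, s, t, ?_, ?_, ?_, by simp [mul_assoc]⟩
      · rwa [mul_assoc, mul_assoc, rightCoset_conjSubgroup_eq_iff]
      · rw [← moveEdge_edgeAt, ← moveEdge_edgeAt]
        exact (moveEdge_injective γ).ne h2
      · rwa [← moveEdge_edgeAt, ← moveEdge_edgeAt, ← Set.image_pair, isMarked_move]

theorem coverPair_move (γ : F₂) (K : Subgroup F₂) (w : TwoCell K → Prop × Prop) :
    coverPair (conjSubgroup γ K) (fun c => w (unmoveCell γ K c))
      = (conjSubgroup γ (coverPair K w).1, conjSubgroup γ (coverPair K w).2) :=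
  Prod.ext (coverSubgroup_move γ K {c | (w c).1}) (coverSubgroup_move γ K {c | (w c).2})

end Conjugation

/-! ### The base subgroup has finitely many conjugates -/

section Conjugates

/-- Induction on a word for `g`. Suppose `h x^k ∈ N` and `y^r` is appended. If `n ∣ k`, then `h ∈ N`
and `y^{-r}` undoes the new factor. Otherwise `h y^r x^k = (h x^k)(x^{-k} y^r x^k)` stays in `N`. -/
theorem exists_mul_zpow_mem {G : Type*} [Group G] {N : Subgroup G} {a b : G} {n : ℤ}
    (hgen : Subgroup.closure {a, b} = ⊤) (ha : a ^ n ∈ N) (hb : b ^ n ∈ N)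
    (hab : ∀ k r : ℤ, ¬ n ∣ k → a ^ k * b ^ r * (a ^ k)⁻¹ ∈ N)
    (hba : ∀ k r : ℤ, ¬ n ∣ k → b ^ k * a ^ r * (b ^ k)⁻¹ ∈ N) (g : G) :
    ∃ k : ℤ, g * a ^ k ∈ N ∨ g * b ^ k ∈ N := by
  have hstep : ∀ (x y : G), x ^ n ∈ N → (∀ k r : ℤ, ¬ n ∣ k → x ^ k * y ^ r * (x ^ k)⁻¹ ∈ N) →
      ∀ (h : G) (r k : ℤ), h * x ^ k ∈ N →
        ∃ k : ℤ, h * y ^ r * x ^ k ∈ N ∨ h * y ^ r * y ^ k ∈ N := by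
    intro x y hx hxy h r k hk
    by_cases hd : n ∣ k
    · obtain ⟨m, rfl⟩ := hd
      refine ⟨-r, Or.inr ?_⟩
      rw [zpow_mul] at hk
      simpa [mul_assoc] using (N.mul_mem_cancel_right (N.zpow_mem hx m)).1 hk
    · refine ⟨k, Or.inl ?_⟩
      have := N.mul_mem hk (hxy (-k) r (by rwa [dvd_neg]))
      simpa [mul_assoc] using this
  have hmul : ∀ (h : G) (r : ℤ), (∃ k : ℤ, h * a ^ k ∈ N ∨ h * b ^ k ∈ N) →
      (∃ k : ℤ, h * a ^ r * a ^ k ∈ N ∨ h * a ^ r * b ^ k ∈ N) ∧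
      ∃ k : ℤ, h * b ^ r * a ^ k ∈ N ∨ h * b ^ r * b ^ k ∈ N := by
    rintro h r ⟨k, hk | hk⟩
    · exact ⟨⟨k - r, Or.inl (by rwa [mul_assoc, ← zpow_add, add_sub_cancel])⟩,
        hstep a b ha hab h r k hk⟩
    · exact ⟨(hstep b a hb hba h r k hk).imp fun _ => Or.symm,
        ⟨k - r, Or.inr (by rwa [mul_assoc, ← zpow_add, add_sub_cancel])⟩⟩
  have hmem : g ∈ Subgroup.closure {a, b} := hgen ▸ Subgroup.mem_top g
  induction hmem using Subgroup.closure_induction_right with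
  | one => exact ⟨0, Or.inl (by simp)⟩
  | mul_right g y _ hy ih =>
    rcases hy with rfl | rfl
    · simpa using (hmul g 1 ih).1
    · simpa using (hmul g 1 ih).2
  | mul_inv_cancel g y _ hy ih =>
    rcases hy with rfl | rfl
    · simpa using (hmul g (-1) ih).1
    · simpa using (hmul g (-1) ih).2

theorem conjSubgroup_eq_of_mem_normalizer {K : Subgroup F₂} {ν : F₂}
    (h : ν ∈ Subgroup.normalizer (K : Set F₂)) :
    conjSubgroup ν K = K :=
  Subgroup.mem_normalizer_iff_map_conj_eq.1 h

theorem closure_generators :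
    Subgroup.closure {FreeGroup.of (0 : Fin 2), FreeGroup.of (1 : Fin 2)} = ⊤ := by
  rw [← FreeGroup.closure_range_of (Fin 2)]
  congr 1
  ext x
  simp [Fin.exists_fin_two, eq_comm]

/-- The generating set of `K_n` is already closed under conjugation by `⟨aⁿ, bⁿ⟩`. -/
theorem closure_pow_le_normalizer_baseSubgroup (n : ℕ) :
    Subgroup.closure {FreeGroup.of (0 : Fin 2) ^ n, FreeGroup.of (1 : Fin 2) ^ n}
      ≤ Subgroup.normalizer (baseSubgroup n : Set F₂) := by
  refine Subgroup.le_normalizer_iff.2 fun g hg => ?_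
  change baseSubgroup n ≤ (baseSubgroup n).comap (MulAut.conj g).toMonoidHom
  refine (Subgroup.closure_le _).2 ?_
  rintro _ ⟨g', hg', k, r, h1, h2, rfl | rfl⟩
  · exact Subgroup.subset_closure ⟨g * g', mul_mem hg hg', k, r, h1, h2, Or.inl (by simp [mul_assoc])⟩
  · exact Subgroup.subset_closure ⟨g * g', mul_mem hg hg', k, r, h1, h2, Or.inr (by simp [mul_assoc])⟩

/-- Every left coset of the normalizer is represented by `a^k` or `b^k` with `0 ≤ k < n`, so there
are at most `2n` conjugates. -/
theorem finite_conjugates_baseSubgroup {n : ℕ} (hn : 1 ≤ n) :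
    (conjugates (baseSubgroup n)).Finite := by
  set K := baseSubgroup n
  set a : F₂ := FreeGroup.of 0
  set b : F₂ := FreeGroup.of 1
  have hn0 : (0 : ℤ) < n := by exact_mod_cast hn
  have hN : Subgroup.closure {a ^ n, b ^ n} ≤ Subgroup.normalizer (K : Set F₂) :=
    closure_pow_le_normalizer_baseSubgroup n
  have haH : a ^ (n : ℤ) ∈ Subgroup.closure {a ^ n, b ^ n} := by
    rw [zpow_natCast]
    exact Subgroup.subset_closure (Or.inl rfl)
  have hbH : b ^ (n : ℤ) ∈ Subgroup.closure {a ^ n, b ^ n} := by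
    rw [zpow_natCast]
    exact Subgroup.subset_closure (Or.inr rfl)
  have hrem : ∀ k : ℤ, ¬ (n : ℤ) ∣ k → 1 ≤ |k % n| ∧ |k % n| ≤ (n : ℤ) - 1 := by
    intro k hk
    have h0 := Int.emod_nonneg k hn0.ne'
    have h1 := Int.emod_lt_of_pos k hn0
    have h2 : k % n ≠ 0 := fun h => hk (Int.dvd_of_emod_eq_zero h)
    rw [abs_of_nonneg h0]
    omega
  -- The multiple of `n` in the exponent is absorbed into the conjugating element of `⟨aⁿ, bⁿ⟩`; the
  -- remainder lies in the range allowed for the generators of `K_n`.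
  have hsplit : ∀ (x : F₂) (k : ℤ), x ^ k = (x ^ (n : ℤ)) ^ (k / n) * x ^ (k % n) := by
    intro x k
    rw [← zpow_mul, ← zpow_add, Int.mul_ediv_add_emod]
  have hab : ∀ k r : ℤ, ¬ (n : ℤ) ∣ k → a ^ k * b ^ r * (a ^ k)⁻¹ ∈ Subgroup.normalizer (K : Set F₂) := by
    refine fun k r hk => Subgroup.le_normalizer (Subgroup.subset_closure
      ⟨(a ^ (n : ℤ)) ^ (k / n), zpow_mem haH _, k % n, r, (hrem k hk).1, (hrem k hk).2, Or.inl ?_⟩)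
    rw [hsplit a k]
    simp only [mul_inv_rev, mul_assoc]
    rfl
  have hba : ∀ k r : ℤ, ¬ (n : ℤ) ∣ k → b ^ k * a ^ r * (b ^ k)⁻¹ ∈ Subgroup.normalizer (K : Set F₂) := by
    refine fun k r hk => Subgroup.le_normalizer (Subgroup.subset_closure
      ⟨(b ^ (n : ℤ)) ^ (k / n), zpow_mem hbH _, k % n, r, (hrem k hk).1, (hrem k hk).2, Or.inr ?_⟩)
    rw [hsplit b k]
    simp only [mul_inv_rev, mul_assoc]
    rfl
  have hconj : ∀ x : F₂, x ^ (n : ℤ) ∈ Subgroup.normalizer (K : Set F₂) →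
      ∀ (g : F₂) (k : ℤ), g⁻¹ * x ^ k ∈ Subgroup.normalizer (K : Set F₂) →
        conjSubgroup g K = conjSubgroup (x ^ (k % n)) K := by
    intro x hx g k hk
    have h : g = x ^ (k % n) * ((x ^ (n : ℤ)) ^ (k / n) * (g⁻¹ * x ^ k)⁻¹) := by
      rw [mul_inv_rev, inv_inv, ← mul_assoc, ← mul_assoc, ← zpow_mul, ← zpow_add,
        Int.emod_add_mul_ediv, mul_inv_cancel, one_mul]
    nth_rewrite 1 [h]
    rw [conjSubgroup_mul, conjSubgroup_eq_of_mem_normalizer (mul_mem (zpow_mem hx _) (inv_mem hk))]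
  refine Set.Finite.subset (((Set.finite_Ico (0 : ℤ) n).image fun k => conjSubgroup (a ^ k) K).union
    ((Set.finite_Ico (0 : ℤ) n).image fun k => conjSubgroup (b ^ k) K)) ?_
  rintro _ ⟨g, rfl⟩
  -- Applied to `g⁻¹`, because `g⁻¹ x^k` in the normalizer says that `g` and `x^k` give the same
  -- conjugate.
  obtain ⟨k, hk | hk⟩ := exists_mul_zpow_mem closure_generators (hN haH) (hN hbH) hab hba g⁻¹
  · exact Or.inl ⟨k % n, ⟨Int.emod_nonneg k hn0.ne', Int.emod_lt_of_pos k hn0⟩,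
      (hconj a (hN haH) g k hk).symm⟩
  · exact Or.inr ⟨k % n, ⟨Int.emod_nonneg k hn0.ne', Int.emod_lt_of_pos k hn0⟩,
      (hconj b (hN hbH) g k hk).symm⟩

end Conjugates

/-! ### The coupling of the percolation paths -/

section PercolationCoupling

/-- The law of the subgroups for the parameters `q` and `p` under the monotone coupling. -/
noncomputable def percolationCoupling (n : ℕ) (p q : I) : Measure (Subgroup F₂ × Subgroup F₂) :=
  ((conjugates (baseSubgroup n)).ncard : ℝ≥0∞)⁻¹ •
    Measure.sum fun K : conjugates (baseSubgroup n) =>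
      (Measure.infinitePi fun _ : TwoCell K.1 => bernoulliCoupling p q).map (coverPair K.1)

theorem percolationIRS_eq (n : ℕ) (p : I) : percolationIRS n p
    = ((conjugates (baseSubgroup n)).ncard : ℝ≥0∞)⁻¹ •
      Measure.sum fun K : conjugates (baseSubgroup n) =>
        (setBernoulli (Set.univ : Set (TwoCell K.1)) p).map fun ω => coverSubgroup ⟨K.1, ω⟩ := by
  rw [percolationIRS, percolation, Measure.map_smul,
    Measure.map_sum measurable_coverSubgroup.aemeasurable]
  congr 3
  funext K
  exact Measure.map_map measurable_coverSubgroup (measurable_marked_mk K.1)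

variable {p q : I}

/-- The larger parameter sits in the first coordinate because it yields the smaller subgroup. -/
theorem map_fst_percolationCoupling (n : ℕ) (h : p ≤ q) :
    (percolationCoupling n p q).map Prod.fst = percolationIRS n q := by
  have := isProbabilityMeasure_bernoulliCoupling h
  rw [percolationCoupling, percolationIRS_eq, Measure.map_smul,
    Measure.map_sum measurable_fst.aemeasurable]
  congr 2
  funext K
  rw [Measure.map_map measurable_fst (measurable_coverPair K.1),
    ← map_infinitePi_eq_setBernoulli measurable_fst (map_fst_bernoulliCoupling h),
    Measure.map_map (g := fun ω => coverSubgroup ⟨K.1, ω⟩)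
      (measurable_coverSubgroup.comp (measurable_marked_mk K.1))]
  · rfl
  · exact measurable_set_iff.2 fun c => measurable_fst.comp (measurable_pi_apply c)

theorem map_snd_percolationCoupling (n : ℕ) (h : p ≤ q) :
    (percolationCoupling n p q).map Prod.snd = percolationIRS n p := by
  have := isProbabilityMeasure_bernoulliCoupling h
  rw [percolationCoupling, percolationIRS_eq, Measure.map_smul,
    Measure.map_sum measurable_snd.aemeasurable]
  congr 2
  funext K
  rw [Measure.map_map measurable_snd (measurable_coverPair K.1),
    ← map_infinitePi_eq_setBernoulli measurable_snd (map_snd_bernoulliCoupling h),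
    Measure.map_map (g := fun ω => coverSubgroup ⟨K.1, ω⟩)
      (measurable_coverSubgroup.comp (measurable_marked_mk K.1))]
  · rfl
  · exact measurable_set_iff.2 fun c => measurable_snd.comp (measurable_pi_apply c)

theorem isProbabilityMeasure_percolationCoupling {n : ℕ} (hn : 1 ≤ n) (h : p ≤ q) :
    IsProbabilityMeasure (percolationCoupling n p q) := by
  have := isProbabilityMeasure_bernoulliCoupling h
  have hfin := finite_conjugates_baseSubgroup hn
  have := hfin.to_subtype
  have hne : (conjugates (baseSubgroup n)).ncard ≠ 0 :=
    ((Set.ncard_pos hfin).2 (Set.range_nonempty _)).ne'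
  have hp : ∀ K : conjugates (baseSubgroup n), (Measure.infinitePi fun _ : TwoCell K.1 =>
      bernoulliCoupling p q).map (coverPair K.1) Set.univ = 1 := fun K => by
    rw [Measure.map_apply (measurable_coverPair K.1) .univ, Set.preimage_univ, measure_univ]
  refine ⟨?_⟩
  rw [percolationCoupling, Measure.smul_apply, Measure.sum_apply _ .univ]
  simp_rw [hp]
  -- Finiteness makes `ncard` the true number of summands; for an infinite class it would be `0` and
  -- the normalization would fail.
  rw [ENNReal.tsum_one, ENat.card_coe_set_eq, ← hfin.cast_ncard_eq, smul_eq_mul]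
  exact ENNReal.inv_mul_cancel (by simpa using hne) (by simp)

/-- Countability lets the almost sure implication at each cell hold at all cells simultaneously. -/
instance (K : Subgroup F₂) : Countable (TwoCell K) := by
  refine ((Set.countable_range fun q : F₂ × Letter × Letter =>
    ({edgeAt K q.1 q.2.1, edgeAt K q.1 q.2.2} : Set SchreierEdge)).mono ?_).to_subtype
  rintro c (⟨g, s, h⟩ | ⟨g, s, t, h, hne⟩)
  · exact ⟨(g, s, s), by simp⟩
  · exact ⟨(g, s, t), rfl⟩

theorem percolationCoupling_ae_le (n : ℕ) (h : p ≤ q) :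
    ∀ᵐ K ∂(percolationCoupling n p q), K.1 ≤ K.2 := by
  have := isProbabilityMeasure_bernoulliCoupling h
  have : Countable (conjugates (baseSubgroup n)) := (Set.countable_range _).to_subtype
  refine Measure.ae_smul_measure (Measure.ae_sum_iff.2 fun K => ?_) _
  have hm : MeasurableSet {L : Subgroup F₂ × Subgroup F₂ | L.1 ≤ L.2} :=
    measurableSet_setOfPred.2 (Measurable.forall fun g =>
      (measurable_fst.mem_subgroup g).imp (measurable_snd.mem_subgroup g))
  refine (ae_map_iff (measurable_coverPair K.1).aemeasurable hm).2 ?_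
  have hw : ∀ᵐ w ∂(Measure.infinitePi fun _ : TwoCell K.1 => bernoulliCoupling p q),
      ∀ c, (w c).2 → (w c).1 := ae_all_iff.2 fun c =>
    (measurePreserving_eval_infinitePi (fun _ : TwoCell K.1 => bernoulliCoupling p q)
      c).quasiMeasurePreserving.ae (bernoulliCoupling_ae_imp p q)
  filter_upwards [hw] with w hw
  exact coverSubgroup_anti fun c hc => hw c hc

/-- Conjugation by `γ` permutes the equally weighted conjugates, and i.i.d. marks stay i.i.d. when
cells are relabelled. -/
theorem map_conj_percolationCoupling (n : ℕ) (h : p ≤ q) (γ : F₂) :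
    (percolationCoupling n p q).map (fun K => (conjSubgroup γ K.1, conjSubgroup γ K.2))
      = percolationCoupling n p q := by
  have := isProbabilityMeasure_bernoulliCoupling h
  have hc : Measurable fun K : Subgroup F₂ × Subgroup F₂ =>
      (conjSubgroup γ K.1, conjSubgroup γ K.2) :=
    ((measurable_conjSubgroup γ).comp measurable_fst).prodMk
      ((measurable_conjSubgroup γ).comp measurable_snd)
  let e : conjugates (baseSubgroup n) ≃ conjugates (baseSubgroup n) :=
    { toFun := fun K => ⟨conjSubgroup γ K.1, by
        obtain ⟨g, hg⟩ := K.2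
        exact ⟨γ * g, by rw [← hg, ← conjSubgroup_mul]⟩⟩
      invFun := fun K => ⟨conjSubgroup γ⁻¹ K.1, by
        obtain ⟨g, hg⟩ := K.2
        exact ⟨γ⁻¹ * g, by rw [← hg, ← conjSubgroup_mul]⟩⟩
      left_inv := fun K => Subtype.ext (by
        simp only [← conjSubgroup_mul, inv_mul_cancel, conjSubgroup_one])
      right_inv := fun K => Subtype.ext (by
        simp only [← conjSubgroup_mul, mul_inv_cancel, conjSubgroup_one]) }
  rw [percolationCoupling, Measure.map_smul, Measure.map_sum hc.aemeasurable]
  congr 1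
  conv_rhs => rw [← Measure.sum_comp_equiv e]
  congr 1
  funext K
  rw [Measure.map_map hc (measurable_coverPair K.1)]
  have hm : Measurable fun (w : TwoCell K.1 → Prop × Prop) (c : TwoCell (conjSubgroup γ K.1)) =>
      w (unmoveCell γ K.1 c) := by fun_prop
  change _ = (Measure.infinitePi fun _ : TwoCell (conjSubgroup γ K.1) => bernoulliCoupling p q).map
    (coverPair (conjSubgroup γ K.1))
  -- Reading a product measure along an injection of the index sets gives a product measure again,
  -- so injectivity of `unmoveCell` is enough.
  rw [← Measure.map_infinitePi_infinitePi_of_inj (P := fun _ : TwoCell K.1 => bernoulliCoupling p q)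
    (unmoveCell_injective γ K.1), Measure.map_map (measurable_coverPair _) hm]
  congr 1
  funext w
  exact (coverPair_move γ K.1 w).symm

end PercolationCoupling

theorem isAdmissible_uniformStep : IsAdmissible uniformStep := by
  have hs : ∀ s : Letter, s.elt ∈ Subsemigroup.closure {g : F₂ | uniformStep {g} ≠ 0} := by
    intro s
    refine Subsemigroup.subset_closure ?_
    simp only [uniformStep, Set.mem_ofPred_eq, Measure.smul_apply, Measure.finsetSum_apply,
      smul_eq_mul, ne_eq, mul_eq_zero, not_or]
    refine ⟨by simp, fun h => ?_⟩
    have := (Finset.sum_eq_zero_iff.1 h) s (Finset.mem_univ s)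
    simp at this
  refine (Subsemigroup.eq_top_iff' _).2 fun g => ?_
  rw [← FreeGroup.mk_toWord (x := g)]
  generalize g.toWord = L
  induction L with
  | nil =>
    -- A semigroup contains no empty product, so the identity is written as `a a⁻¹`.
    have h1 : Letter.elt (0, true) * Letter.elt (0, false) = FreeGroup.mk [] :=
      mul_inv_cancel (FreeGroup.of (0 : Fin 2))
    exact h1 ▸ Subsemigroup.mul_mem _ (hs (0, true)) (hs (0, false))
  | cons s L ih => exact Subsemigroup.mul_mem _ (hs s) ih

end IRSWalk

/-- First part: monotonicity of the entropy under conjugation-invariant couplings with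
`K₁ ≤ K₂`. Second part: the entropy increases along the percolation paths. -/
theorem corollary4p9 :
    (∀ (G : Type*) [Group G] [Countable G] [MeasurableSpace G] [DiscreteMeasurableSpace G]
      (μ : Measure G) [IsProbabilityMeasure μ], IRSWalk.IsAdmissible μ →
      IRSWalk.HasFiniteEntropy μ →
      ∀ (ρ : Measure (Subgroup G × Subgroup G)) [IsProbabilityMeasure ρ],
        (∀ᵐ K ∂ρ, K.1 ≤ K.2) →
        (∀ γ : G, ρ.map
          (fun K => (IRSWalk.conjSubgroup γ K.1, IRSWalk.conjSubgroup γ K.2)) = ρ) →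
        ∀ (B₁ : IRSWalk.PoissonBoundary μ (ρ.map Prod.fst))
          (B₂ : IRSWalk.PoissonBoundary μ (ρ.map Prod.snd)),
          B₂.entropy ≤ B₁.entropy) ∧
    (∀ n : ℕ, 1 ≤ n →
      ∀ B : ∀ p : unitInterval,
          IRSWalk.PoissonBoundary IRSWalk.uniformStep (IRSWalk.percolationIRS n p),
        Monotone fun p => (B p).entropy) := by
  refine ⟨fun G _ _ _ _ μ _ hμ _ ρ _ hle hinv B₁ B₂ =>
    IRSWalk.entropy_le_of_coupling hμ ρ hle hinv B₁ B₂, fun n hn B p q hpq => ?_⟩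
  have := IRSWalk.isProbabilityMeasure_percolationCoupling hn hpq
  -- The type of a boundary depends on the law, so the laws are generalized before the marginals are
  -- substituted for them.
  have key : ∀ lam₁ lam₂ : Measure (Subgroup IRSWalk.F₂),
      (IRSWalk.percolationCoupling n p q).map Prod.fst = lam₁ →
      (IRSWalk.percolationCoupling n p q).map Prod.snd = lam₂ →
      ∀ (B₁ : IRSWalk.PoissonBoundary IRSWalk.uniformStep lam₁)
        (B₂ : IRSWalk.PoissonBoundary IRSWalk.uniformStep lam₂), B₂.entropy ≤ B₁.entropy := by
    rintro _ _ rfl rfl B₁ B₂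
    exact IRSWalk.entropy_le_of_coupling IRSWalk.isAdmissible_uniformStep _
      (IRSWalk.percolationCoupling_ae_le n hpq) (IRSWalk.map_conj_percolationCoupling n hpq) B₁ B₂
  exact key _ _ (IRSWalk.map_fst_percolationCoupling n hpq)
    (IRSWalk.map_snd_percolationCoupling n hpq) _ _
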